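/- Let $R$ be a commutative noetherian local ring with maximal ideal $\mathfrak m$, residue field $k=R/\mathfrak m$ and $\mathfrak m$-adic completion $\widehat R$. Let $A$ and $L$ be $R$-modules such that $A$ is artinian, and assume that the ring $R/(\operatorname{Ann}_R(A)+\operatorname{Ann}_R(L))$ is ($\mathfrak m$-adically) complete. Let $i\ge 0$ be an integer. 1. If the Bass number $\mu^i_R(L)=\operatorname{len}_R(\operatorname{Ext}^i_R(k,L))$ is finite, then $\operatorname{Ext}^i_R(A,L)$ is noetherian and Matlis reflexive, over $R$ and over $\widehat R$. 2. If the Betti number $\beta_i^R(L)=\operatorname{len}_R(\operatorname{Tor}_i^R(k,L))$ is finite, then $\operatorname{Tor}_i^R(A,L)$ is artinian and Matlis reflexive, over $R$ and over $\widehat R$. Here a module $M$ over a commutative local ring $S$ is Matlis reflexive over $S$ if the biduality map $M\to\operatorname{Hom}_S(\operatorname{Hom}_S(M,E),E)$, $x\mapsto(\psi\mapsto\psi(x))$, is an isomorphism, where $E$ is the injective hull of the residue field of $S$. The $\widehat R$-module structures on $\operatorname{Ext}^i_R(A,L)$ and $\operatorname{Tor}_i^R(A,L)$ are induced by functoriality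 from the one on $A$: every $x\in A$ is killed by some $\mathfrak m^n$, and $r\in\widehat R$ acts by $rx=r_0x$ for any $r_0\in R$ with the same image as $r$ in $R/\mathfrak m^n$. -/

import Mathlib

open CategoryTheory IsLocalRing

universe u

/-! ### Injective hulls and Matlis reflexive modules -/

/-- `ι : M → E` exhibits `E` as an injective hull of `M`: the map `ι` is injective, `E` is an
injective module, and every nonzero submodule of `E` meets the image of `ι` nontrivially. -/
structure IsInjectiveHull {R M E : Type u} [CommRing R] [AddCommGroup M] [Module R M]
    [AddCommGroup E] [Module R E] (ι : M →ₗ[R] E) : Prop where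
  injective_map : Function.Injective ι
  injective_module : Module.Injective R E
  essential : ∀ N : Submodule R E, N ⊓ LinearMap.range ι = ⊥ → N = ⊥

/-- The biduality map `M → Hom (Hom (M, E), E)`, `x ↦ (ψ ↦ ψ x)`. -/
def bidualityMap (R M E : Type u) [CommRing R] [AddCommGroup M] [Module R M]
    [AddCommGroup E] [Module R E] : M →ₗ[R] ((M →ₗ[R] E) →ₗ[R] E) where
  toFun x :=
    { toFun := fun ψ => ψ x
      map_add' := fun _ _ => rfl
      map_smul' := fun _ _ => rfl }
  map_add' x y := by ext ψ; exact map_add ψ x y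
  map_smul' r x := by ext ψ; exact map_smul ψ r x

/-- A module `M` over a local ring `R` is Matlis reflexive if the biduality map
`M → Hom (Hom (M, E), E)` is an isomorphism, where `E` is the injective hull of the residue field.
As injective hulls are unique up to isomorphism, it does not matter which one is used. -/
def IsMatlisReflexive (R M : Type u) [CommRing R] [IsLocalRing R] [AddCommGroup M]
    [Module R M] : Prop :=
  ∃ (E : Type u) (_ : AddCommGroup E) (_ : Module R E) (ι : ResidueField R →ₗ[R] E),
    IsInjectiveHull ι ∧ Function.Bijective (bidualityMap R M E)

/-! ### Ext, Tor, Bass numbers and Betti numbers -/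

/-- `Ext^i_R(M, N)`. -/
abbrev ExtMod (R M N : Type u) [CommRing R] [AddCommGroup M] [Module R M]
    [AddCommGroup N] [Module R N] (i : ℕ) : Type u :=
  Abelian.Ext (ModuleCat.of R M) (ModuleCat.of R N) i

/-- `Tor_i^R(M, N)`. -/
abbrev TorMod (R M N : Type u) [CommRing R] [AddCommGroup M] [Module R M]
    [AddCommGroup N] [Module R N] (i : ℕ) : Type u :=
  (((Tor (ModuleCat.{u} R) i).obj (ModuleCat.of R M)).obj (ModuleCat.of R N) : ModuleCat.{u} R)

/-- The `i`-th Bass number of `L`: the length of `Ext^i_R(k, L)`. -/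
noncomputable def bassNumber (R L : Type u) [CommRing R] [IsLocalRing R] [AddCommGroup L]
    [Module R L] (i : ℕ) : ℕ∞ :=
  Module.length R (ExtMod R (ResidueField R) L i)

/-- The `i`-th Betti number of `L`: the length of `Tor_i^R(k, L)`. -/
noncomputable def bettiNumber (R L : Type u) [CommRing R] [IsLocalRing R] [AddCommGroup L]
    [Module R L] (i : ℕ) : ℕ∞ :=
  Module.length R (TorMod R (ResidueField R) L i)

/-! ### The action of the completion on an artinian module -/

/-- The completion of a local ring with respect to its maximal ideal. -/
abbrev MCompletion (R : Type u) [CommRing R] [IsLocalRing R] : Type u :=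
  AdicCompletion (maximalIdeal R) R

section CompletionAction

variable {R A : Type u} [CommRing R] [IsNoetherianRing R] [IsLocalRing R]
  [AddCommGroup A] [Module R A] [IsArtinian R A]

/-- Artinian modules over a noetherian local ring are torsion for the maximal ideal. -/
theorem exists_maximalIdeal_pow_smul_eq_zero (x : A) :
    ∃ n : ℕ, ∀ a ∈ maximalIdeal R ^ n, a • x = 0 := by
  let N : ℕ → Submodule R A := fun n => (maximalIdeal R ^ n) • Submodule.span R {x}
  have hanti : Antitone N := fun a b h => Submodule.smul_mono_left (Ideal.pow_le_pow_right h)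
  obtain ⟨n, hn⟩ := IsArtinian.monotone_stabilizes (R := R) (M := A)
    ⟨fun n => OrderDual.toDual (N n), fun a b h => hanti h⟩
  have h1 : N n = N (n + 1) := OrderDual.toDual.injective (hn (n + 1) n.le_succ)
  have h2 : N (n + 1) = maximalIdeal R • N n := by
    simp only [N, pow_succ', Submodule.mul_smul]
  have hfg : (N n).FG :=
    Submodule.FG.smul (IsNoetherian.noetherian _) (Submodule.fg_span_singleton x)
  have h3 : N n = ⊥ := by
    refine Submodule.eq_bot_of_le_smul_of_le_jacobson_bot (maximalIdeal R) _ hfg ?_ ?_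
    · exact (h1.trans h2).le
    · exact (jacobson_eq_maximalIdeal ⊥ bot_ne_top).ge
  refine ⟨n, fun a ha => ?_⟩
  have : a • x ∈ N n := Submodule.smul_mem_smul ha (Submodule.mem_span_singleton_self x)
  rw [h3] at this
  exact (Submodule.mem_bot R).1 this

/-- The product `r x` for `r` in the completion and `x` in an artinian module: choose `n` such that
the `n`-th power of the maximal ideal kills `x`, choose an element `a` of `R` with the same image as
`r` modulo this power, and set `r x = a x`. -/
noncomputable def completionSMul (r : MCompletion R) (x : A) : A :=
  Quotient.out (AdicCompletion.evalₐ (maximalIdeal R)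
    (exists_maximalIdeal_pow_smul_eq_zero (R := R) x).choose r) • x

theorem completionSMul_eq (r : MCompletion R) (x : A) (n : ℕ)
    (hn : ∀ a ∈ maximalIdeal R ^ n, a • x = 0) (a : R)
    (ha : AdicCompletion.evalₐ (maximalIdeal R) n r = Ideal.Quotient.mk _ a) :
    completionSMul r x = a • x := by
  obtain ⟨f, rfl⟩ := AdicCompletion.mk_surjective (maximalIdeal R) R r
  have key : ∀ (j p : ℕ) (b : R), j ≤ p → (∀ c ∈ maximalIdeal R ^ j, c • x = 0) →
      AdicCompletion.evalₐ (maximalIdeal R) j (AdicCompletion.mk _ R f) =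
        Ideal.Quotient.mk _ b → b • x = f.val p • x := by
    intro j p b hjp hj hb
    rw [AdicCompletion.evalₐ_mk, ← AdicCompletion.Ideal.mk_eq_mk (maximalIdeal R) hjp f, Ideal.Quotient.eq] at hb
    have := hj _ hb
    rw [sub_smul, sub_eq_zero] at this
    exact this.symm
  have hm := (exists_maximalIdeal_pow_smul_eq_zero (R := R) x).choose_spec
  set m := (exists_maximalIdeal_pow_smul_eq_zero (R := R) x).choose with hmdef
  rw [key n (max n m) a (le_max_left _ _) hn ha]
  refine key m (max n m) _ (le_max_right _ _) hm ?_
  exact (Quotient.out_eq _).symm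

/-- The `R`-linear endomorphism of an artinian `R`-module `A` given by the action of an element of
the completion of `R`. -/
noncomputable def completionEnd (A : Type u) [AddCommGroup A] [Module R A] [IsArtinian R A]
    (r : MCompletion R) : A →ₗ[R] A where
  toFun x := completionSMul r x
  map_add' x y := by
    obtain ⟨n, hn⟩ := exists_maximalIdeal_pow_smul_eq_zero (R := R) x
    obtain ⟨m, hm⟩ := exists_maximalIdeal_pow_smul_eq_zero (R := R) y
    have hn' : ∀ a ∈ maximalIdeal R ^ (max n m), a • x = 0 :=
      fun a ha => hn a (Ideal.pow_le_pow_right (le_max_left _ _) ha)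
    have hm' : ∀ a ∈ maximalIdeal R ^ (max n m), a • y = 0 :=
      fun a ha => hm a (Ideal.pow_le_pow_right (le_max_right _ _) ha)
    obtain ⟨a, ha⟩ := Ideal.Quotient.mk_surjective
      (AdicCompletion.evalₐ (maximalIdeal R) (max n m) r)
    rw [completionSMul_eq r x _ hn' a ha.symm, completionSMul_eq r y _ hm' a ha.symm,
      completionSMul_eq r (x + y) (max n m) ?_ a ha.symm, smul_add]
    intro b hb
    rw [smul_add, hn' b hb, hm' b hb, add_zero]
  map_smul' c x := by
    obtain ⟨n, hn⟩ := exists_maximalIdeal_pow_smul_eq_zero (R := R) x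
    obtain ⟨a, ha⟩ := Ideal.Quotient.mk_surjective
      (AdicCompletion.evalₐ (maximalIdeal R) n r)
    rw [completionSMul_eq r x _ hn a ha.symm, completionSMul_eq r (c • x) n ?_ a ha.symm,
      smul_comm, RingHom.id_apply]
    intro b hb
    rw [smul_comm, hn b hb, smul_zero]

theorem completionEnd_apply_eq (r : MCompletion R) (x : A) (n : ℕ)
    (hn : ∀ a ∈ maximalIdeal R ^ n, a • x = 0) (a : R)
    (ha : AdicCompletion.evalₐ (maximalIdeal R) n r = Ideal.Quotient.mk _ a) :
    completionEnd A r x = a • x :=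
  completionSMul_eq r x n hn a ha

theorem completionEnd_algebraMap (a : R) :
    completionEnd A (algebraMap R (MCompletion R) a) = a • LinearMap.id := by
  ext x
  obtain ⟨n, hn⟩ := exists_maximalIdeal_pow_smul_eq_zero (R := R) x
  exact completionEnd_apply_eq _ x n hn a (AlgHom.commutes _ a)

theorem completionEnd_one : completionEnd A (1 : MCompletion R) = LinearMap.id := by
  rw [← map_one (algebraMap R (MCompletion R)), completionEnd_algebraMap, one_smul]

theorem completionEnd_zero : completionEnd A (0 : MCompletion R) = 0 := by
  rw [← map_zero (algebraMap R (MCompletion R)), completionEnd_algebraMap, zero_smul]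

theorem completionEnd_add (r s : MCompletion R) :
    completionEnd A (r + s) = completionEnd A r + completionEnd A s := by
  ext x
  obtain ⟨n, hn⟩ := exists_maximalIdeal_pow_smul_eq_zero (R := R) x
  obtain ⟨a, ha⟩ := Ideal.Quotient.mk_surjective (AdicCompletion.evalₐ (maximalIdeal R) n r)
  obtain ⟨b, hb⟩ := Ideal.Quotient.mk_surjective (AdicCompletion.evalₐ (maximalIdeal R) n s)
  rw [LinearMap.add_apply, completionEnd_apply_eq r x n hn a ha.symm,
    completionEnd_apply_eq s x n hn b hb.symm,
    completionEnd_apply_eq (r + s) x n hn (a + b) (by rw [map_add, map_add, ha, hb]), add_smul]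

theorem completionEnd_mul (r s : MCompletion R) :
    completionEnd A (r * s) = completionEnd A r ∘ₗ completionEnd A s := by
  ext x
  obtain ⟨n, hn⟩ := exists_maximalIdeal_pow_smul_eq_zero (R := R) x
  obtain ⟨a, ha⟩ := Ideal.Quotient.mk_surjective (AdicCompletion.evalₐ (maximalIdeal R) n r)
  obtain ⟨b, hb⟩ := Ideal.Quotient.mk_surjective (AdicCompletion.evalₐ (maximalIdeal R) n s)
  rw [LinearMap.comp_apply, completionEnd_apply_eq s x n hn b hb.symm, map_smul,
    completionEnd_apply_eq r x n hn a ha.symm,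
    completionEnd_apply_eq (r * s) x n hn (a * b) (by rw [map_mul, map_mul, ha, hb]),
    mul_smul, smul_comm]

theorem completionEnd_comm (r s : MCompletion R) :
    completionEnd A r ∘ₗ completionEnd A s = completionEnd A s ∘ₗ completionEnd A r := by
  rw [← completionEnd_mul, mul_comm, completionEnd_mul]

end CompletionAction

/-! ### The induced action of the completion on Ext and Tor -/

/-- `Tor_i^R(-, N)` is additive in the first variable. -/
theorem tor_map_add_app {R : Type u} [CommRing R] {M M' : ModuleCat.{u} R} (f g : M ⟶ M') (N : ModuleCat.{u} R) (i : ℕ) :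
    ((Tor (ModuleCat.{u} R) i).map (f + g)).app N =
      ((Tor (ModuleCat.{u} R) i).map f).app N + ((Tor (ModuleCat.{u} R) i).map g).app N := by
  have h : (NatTrans.mapHomologicalComplex
        ((MonoidalCategory.tensoringLeft (ModuleCat.{u} R)).map (f + g))
          (ComplexShape.down ℕ)).app (projectiveResolution N).complex =
      (NatTrans.mapHomologicalComplex
        ((MonoidalCategory.tensoringLeft (ModuleCat.{u} R)).map f)
          (ComplexShape.down ℕ)).app (projectiveResolution N).complex +
      (NatTrans.mapHomologicalComplex
        ((MonoidalCategory.tensoringLeft (ModuleCat.{u} R)).map g)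
          (ComplexShape.down ℕ)).app (projectiveResolution N).complex := by
    ext j : 1
    exact MonoidalPreadditive.add_whiskerRight f g
  simp only [Tor_map]
  rw [ProjectiveResolution.leftDerived_app_eq _ (projectiveResolution N),
    ProjectiveResolution.leftDerived_app_eq _ (projectiveResolution N),
    ProjectiveResolution.leftDerived_app_eq _ (projectiveResolution N), h, CategoryTheory.Functor.map_add,
    Preadditive.add_comp, Preadditive.comp_add]
  rfl

section InducedAction

variable {R A L : Type u} [CommRing R] [IsNoetherianRing R] [IsLocalRing R]
  [AddCommGroup A] [Module R A] [IsArtinian R A] [AddCommGroup L] [Module R L]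

/-- For an artinian `R`-module `A`, the completion of `R` acts on `Ext^i_R(A, L)` through its
action on `A` and the functoriality of Ext in the first variable. -/
noncomputable instance ExtMod.completionModule (i : ℕ) :
    Module (MCompletion R) (ExtMod R A L i) where
  smul r e := (Abelian.Ext.mk₀ (ModuleCat.ofHom (completionEnd A r))).comp e (zero_add i)
  one_smul e := by
    change (Abelian.Ext.mk₀ (ModuleCat.ofHom (completionEnd A 1))).comp e (zero_add i) = e
    rw [completionEnd_one, ModuleCat.ofHom_id, Abelian.Ext.mk₀_id_comp]
  mul_smul r s e := by
    change (Abelian.Ext.mk₀ (ModuleCat.ofHom (completionEnd A (r * s)))).comp e (zero_add i) =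
      (Abelian.Ext.mk₀ (ModuleCat.ofHom (completionEnd A r))).comp
        ((Abelian.Ext.mk₀ (ModuleCat.ofHom (completionEnd A s))).comp e (zero_add i)) (zero_add i)
    rw [Abelian.Ext.mk₀_comp_mk₀_assoc, ← ModuleCat.ofHom_comp, completionEnd_mul,
      completionEnd_comm]
  smul_zero r := Abelian.Ext.comp_zero _ _ _ _ _
  smul_add r e f := Abelian.Ext.comp_add _ _ _ _
  add_smul r s e := by
    change (Abelian.Ext.mk₀ (ModuleCat.ofHom (completionEnd A (r + s)))).comp e (zero_add i) =
      (Abelian.Ext.mk₀ (ModuleCat.ofHom (completionEnd A r))).comp e (zero_add i) +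
      (Abelian.Ext.mk₀ (ModuleCat.ofHom (completionEnd A s))).comp e (zero_add i)
    rw [completionEnd_add, ModuleCat.ofHom_add, Abelian.Ext.mk₀_add, Abelian.Ext.add_comp]
  zero_smul e := by
    change (Abelian.Ext.mk₀ (ModuleCat.ofHom (completionEnd A 0))).comp e (zero_add i) = 0
    rw [completionEnd_zero, ModuleCat.ofHom_zero, Abelian.Ext.mk₀_zero, Abelian.Ext.zero_comp]

/-- For an artinian `R`-module `A`, the completion of `R` acts on `Tor_i^R(A, L)` through its
action on `A` and the functoriality of Tor in the first variable. -/
noncomputable instance TorMod.completionModule (i : ℕ) :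
    Module (MCompletion R) (TorMod R A L i) where
  smul r e := ((Tor (ModuleCat.{u} R) i).map (ModuleCat.ofHom (completionEnd A r))).app
    (ModuleCat.of R L) e
  one_smul e := by
    change ((Tor (ModuleCat.{u} R) i).map (ModuleCat.ofHom (completionEnd A 1))).app
      (ModuleCat.of R L) e = e
    rw [completionEnd_one, ModuleCat.ofHom_id, CategoryTheory.Functor.map_id]
    rfl
  mul_smul r s e := by
    change ((Tor (ModuleCat.{u} R) i).map (ModuleCat.ofHom (completionEnd A (r * s)))).app
        (ModuleCat.of R L) e =
      ((Tor (ModuleCat.{u} R) i).map (ModuleCat.ofHom (completionEnd A r))).app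
        (ModuleCat.of R L)
        (((Tor (ModuleCat.{u} R) i).map (ModuleCat.ofHom (completionEnd A s))).app
          (ModuleCat.of R L) e)
    rw [completionEnd_mul, ModuleCat.ofHom_comp, CategoryTheory.Functor.map_comp]
    rfl
  smul_zero r := map_zero (((Tor (ModuleCat.{u} R) i).map
    (ModuleCat.ofHom (completionEnd A r))).app (ModuleCat.of R L)).hom
  smul_add r e f := map_add (((Tor (ModuleCat.{u} R) i).map
    (ModuleCat.ofHom (completionEnd A r))).app (ModuleCat.of R L)).hom e f
  add_smul r s e := by
    change ((Tor (ModuleCat.{u} R) i).map (ModuleCat.ofHom (completionEnd A (r + s)))).app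
        (ModuleCat.of R L) e =
      ((Tor (ModuleCat.{u} R) i).map (ModuleCat.ofHom (completionEnd A r))).app
        (ModuleCat.of R L) e +
      ((Tor (ModuleCat.{u} R) i).map (ModuleCat.ofHom (completionEnd A s))).app
        (ModuleCat.of R L) e
    rw [completionEnd_add, ModuleCat.ofHom_add, tor_map_add_app]
    rfl
  zero_smul e := by
    change ((Tor (ModuleCat.{u} R) i).map (ModuleCat.ofHom (completionEnd A 0))).app
        (ModuleCat.of R L) e = 0
    have h := tor_map_add_app (0 : ModuleCat.of R A ⟶ ModuleCat.of R A) 0 (ModuleCat.of R L) i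
    rw [add_zero, left_eq_add] at h
    rw [completionEnd_zero, ModuleCat.ofHom_zero, h]
    rfl

end InducedAction

/-! ### Existence of injective hulls -/

section InjectiveHulls

/-! Both parts rest on one finiteness statement, `isNoetherian_of_surjective_hom`. Dimension
shifting presents `Ext^i(-, L)` as the cokernel of `Hom(-, I) → Hom(-, Z)` for a map `d : I → Z`
with `I` injective. An injective `P ⊆ I` maximal among submodules meeting `ker d` trivially splits
off from `Z`, say `Z = d(P) ⊕ Q`. Maximality makes `Hom(k, Q)` embed in `Ext^i(k, L)`, so a finite
Bass number gives `Q` an artinian socle, while `Hom(A, Q)` still surjects onto `Ext^i(A, L)`.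

Finitely many functionals `Q → E` separate the socle of `Q`, so `Hom(A, Q)` embeds in a finite power
of `Hom(A, E)`. The latter is noetherian over `End E`, and endomorphisms of `E` act on it through
the completion (`isNoetherian_completion_dual`). Finally `J = Ann A + Ann L` kills Ext and `R ⧸ J`
is complete, so the completion acts on Ext through `R`, and Ext is noetherian over `R`.

For Tor, tensor-hom adjunction presents the Matlis dual of `Tor_i(-, L)` in the same way. The dual
of `Tor_i(A, L)` is therefore noetherian, and `Tor_i(A, L)` is artinian.

A noetherian module killed by `J` is complete, hence a limit of finite length modules, and so
reflexive. An artinian module killed by `J` has a noetherian dual; that dual is reflexive, and this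
forces the module itself to be reflexive. -/

theorem Submodule.exists_le_maximal_disjoint {R M : Type*} [Ring R] [AddCommGroup M] [Module R M]
    (K P₀ : Submodule R M) (h : Disjoint P₀ K) :
    ∃ P, P₀ ≤ P ∧ Maximal (fun P => Disjoint P K) P := by
  refine zorn_le_nonempty₀ {P | Disjoint P K} (fun c hc hchain y hy => ?_) P₀ h
  refine ⟨sSup c, ?_, fun z hz => le_sSup hz⟩
  change Disjoint (sSup c) K
  rw [Submodule.disjoint_def]
  intro x hx hxK
  obtain ⟨P, hP, hxP⟩ := (Submodule.mem_sSup_of_directed ⟨y, hy⟩ hchain.directedOn).1 hx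
  exact Submodule.disjoint_def.1 (hc hP) x hxP hxK

variable {R : Type u} [CommRing R]

/-- A submodule of an injective module that is maximal among those disjoint from a given one is a
retract. -/
theorem Module.Injective.exists_retraction_of_maximal_disjoint {I : Type u} [AddCommGroup I]
    [Module R I] [Module.Injective R I] {K P : Submodule R I}
    (hP : Maximal (fun P => Disjoint P K) P) : ∃ π : I →ₗ[R] P, ∀ p : P, π p = p := by
  -- `P` embeds in `I ⧸ C`, and `φ` extends its inclusion into `I`. The range of `φ` contains `P`;
  -- maximality of `C`, then of `P`, forces equality.
  obtain ⟨C, hKC, hC⟩ := Submodule.exists_le_maximal_disjoint P K hP.prop.symm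
  have hinj : Function.Injective (C.mkQ ∘ₗ P.subtype) := by
    rw [← LinearMap.ker_eq_bot, LinearMap.ker_eq_bot']
    intro p hp
    have : (p : I) ∈ C := by simpa using hp
    exact Subtype.ext (Submodule.disjoint_def.1 hC.prop _ this p.2)
  obtain ⟨φ, hφ⟩ := Module.Injective.out (R := R) _ hinj P.subtype
  have hφP : ∀ p ∈ P, φ (C.mkQ p) = p := fun p hp => hφ ⟨p, hp⟩
  have hN : K.comap (φ ∘ₗ C.mkQ) ≤ C := by
    refine hC.le_of_ge ?_ ?_
    · rw [Submodule.disjoint_def]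
      intro x hx hxP
      have : φ (C.mkQ x) ∈ K := hx
      rw [hφP x hxP] at this
      exact Submodule.disjoint_def.1 hP.prop x hxP this
    · intro x hx
      have : C.mkQ x = 0 := by simpa using hx
      simp [this]
  have hrange : LinearMap.range (φ ∘ₗ C.mkQ) ≤ P := by
    refine hP.le_of_ge ?_ fun p hp => ⟨p, hφP p hp⟩
    rw [Submodule.disjoint_def]
    rintro _ ⟨z, rfl⟩ hz
    have : C.mkQ z = 0 := by simpa using hN hz
    simp [this]
  exact ⟨(φ ∘ₗ C.mkQ).codRestrict P fun x => hrange ⟨x, rfl⟩, fun p => Subtype.ext (hφP p p.2)⟩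

theorem Module.Injective.of_retraction {I P : Type u} [AddCommGroup I] [Module R I]
    [AddCommGroup P] [Module R P] [Module.Injective R I] (s : P →ₗ[R] I) (π : I →ₗ[R] P)
    (h : ∀ p, π (s p) = p) : Module.Injective R P where
  out X Y _ _ _ _ f hf g := by
    obtain ⟨k, hk⟩ := Module.Injective.out (R := R) f hf (s ∘ₗ g)
    exact ⟨π ∘ₗ k, fun x => by simp [hk, h]⟩

theorem exists_injective_embedding (R M : Type u) [CommRing R] [AddCommGroup M] [Module R M] :
    ∃ (I : Type u) (_ : AddCommGroup I) (_ : Module R I) (j : M →ₗ[R] I),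
      Module.Injective R I ∧ Function.Injective j := by
  let J : ModuleCat.{u} R := Injective.under (ModuleCat.of R M)
  refine ⟨J, inferInstance, inferInstance,
    (Injective.ι (ModuleCat.of R M)).hom, ?_, ?_⟩
  · exact Module.injective_module_of_injective_object R _ (inj :=
      inferInstanceAs (Injective (Injective.under (ModuleCat.of R M))))
  · exact (ModuleCat.mono_iff_injective _).1 inferInstance

/-- Embed `M` in an injective `I`, take `K` maximal disjoint from `M`, then `P ⊇ M` maximal disjoint
from `K`. As a retract, `P` is injective. A submodule of `P` missing `M` can be added to `K`, so it
lies in `P ⊓ K = ⊥`. -/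
theorem exists_isInjectiveHull (R M : Type u) [CommRing R] [AddCommGroup M] [Module R M] :
    ∃ (E : Type u) (_ : AddCommGroup E) (_ : Module R E) (ι : M →ₗ[R] E), IsInjectiveHull ι := by
  obtain ⟨I, _, _, j, _, hj⟩ := exists_injective_embedding R M
  obtain ⟨K, -, hK⟩ := Submodule.exists_le_maximal_disjoint (LinearMap.range j) ⊥ disjoint_bot_left
  obtain ⟨P, hjP, hP⟩ := Submodule.exists_le_maximal_disjoint K _ hK.prop.symm
  obtain ⟨π, hπ⟩ := Module.Injective.exists_retraction_of_maximal_disjoint hP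
  refine ⟨P, inferInstance, inferInstance, j.codRestrict P fun x => hjP ⟨x, rfl⟩, ?_, ?_, ?_⟩
  · exact fun x y h => hj (congrArg Subtype.val h)
  · exact Module.Injective.of_retraction P.subtype π hπ
  · intro N hN
    have hNP : N.map P.subtype ≤ P := by rintro _ ⟨p, -, rfl⟩; exact p.2
    have hle : N.map P.subtype ⊔ K ≤ K := by
      refine hK.le_of_ge ?_ le_sup_right
      rw [Submodule.disjoint_def]
      rintro x hx ⟨y, rfl⟩
      obtain ⟨_, ⟨p, hp, rfl⟩, κ, hκ, hsum⟩ := Submodule.mem_sup.1 hx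
      have hκP : κ ∈ P := by
        rw [eq_sub_of_add_eq' hsum]
        exact P.sub_mem (hjP ⟨y, rfl⟩) p.2
      have hκ0 : κ = 0 := Submodule.disjoint_def.1 hP.prop κ hκP hκ
      have hpj : p ∈ N ⊓ LinearMap.range (j.codRestrict P fun x => hjP ⟨x, rfl⟩) := by
        refine ⟨hp, y, Subtype.ext ?_⟩
        simpa [hκ0] using hsum.symm
      rw [hN, Submodule.mem_bot] at hpj
      rw [← hsum, hκ0, hpj]
      simp
    rw [Submodule.eq_bot_iff]
    intro p hp
    exact Subtype.ext (Submodule.disjoint_def.1 hP.prop p p.2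
      (hle (Submodule.mem_sup_left ⟨p, hp, rfl⟩)))

end InjectiveHulls

/-! ### Matlis duality for modules of finite length -/

section LocalDuality

variable {R E : Type u} [CommRing R] [IsLocalRing R] [AddCommGroup E] [Module R E]
  {ι : ResidueField R →ₗ[R] E}

namespace IsInjectiveHull

theorem one_ne_zero (hι : IsInjectiveHull ι) : ι 1 ≠ 0 := fun h =>
  _root_.one_ne_zero (hι.injective_map (h.trans (map_zero ι).symm))

theorem smul_one_eq_zero (ι : ResidueField R →ₗ[R] E) {a : R} (ha : a ∈ maximalIdeal R) :
    a • ι 1 = 0 := by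
  rw [← map_smul, Algebra.smul_def, mul_one]
  rw [show algebraMap R (ResidueField R) a = 0 from (residue_eq_zero_iff a).2 ha, map_zero]

theorem one_mem (hι : IsInjectiveHull ι) {N : Submodule R E} (hN : N ≠ ⊥) : ι 1 ∈ N := by
  have h : N ⊓ LinearMap.range ι ≠ ⊥ := fun h => hN (hι.essential N h)
  obtain ⟨_, ⟨hxN, c, rfl⟩, hx⟩ := Submodule.exists_mem_ne_zero_of_ne_bot h
  have hc : c ≠ 0 := by rintro rfl; simp at hx
  obtain ⟨s, hs⟩ := residue_surjective c⁻¹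
  have : ι 1 = s • ι c := by
    rw [← map_smul, Algebra.smul_def]
    change ι 1 = ι (residue R s * c)
    rw [hs, inv_mul_cancel₀ hc]
  rw [this]
  exact N.smul_mem s hxN

/-- The socle of `E` is one copy of the residue field: some multiple `t • e` equals `ι 1`, and `t`
is a unit because the maximal ideal kills `e`. -/
theorem exists_eq_smul_one (hι : IsInjectiveHull ι) {e : E}
    (he : ∀ a ∈ maximalIdeal R, a • e = 0) : ∃ b : R, e = b • ι 1 := by
  by_cases h0 : e = 0
  · exact ⟨0, by simp [h0]⟩
  have h : Submodule.span R {e} ≠ ⊥ := by simpa using h0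
  obtain ⟨t, ht⟩ := Submodule.mem_span_singleton.1 (hι.one_mem h)
  have htu : IsUnit t := by
    by_contra hcon
    exact hι.one_ne_zero (by rw [← ht, he t hcon])
  obtain ⟨u, rfl⟩ := htu
  exact ⟨(u⁻¹ : Rˣ), by rw [← ht, smul_smul]; simp⟩

variable {X : Type u} [AddCommGroup X] [Module R X]

/-- `E` is a cogenerator: the annihilator of `x` lies in the maximal ideal, so `x ↦ ι 1` is well
defined on `R x` and extends by injectivity. -/
theorem exists_apply_ne_zero (hι : IsInjectiveHull ι) {x : X} (hx : x ≠ 0) :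
    ∃ ψ : X →ₗ[R] E, ψ x ≠ 0 := by
  have := hι.injective_module
  let f : R →ₗ[R] X := LinearMap.toSpanSingleton R X x
  have hker : LinearMap.ker f ≤ maximalIdeal R := by
    refine le_maximalIdeal fun h => hx ?_
    have : (1 : R) ∈ LinearMap.ker f := by rw [h]; trivial
    simpa [f] using this
  let g : R →ₗ[R] E := LinearMap.toSpanSingleton R E (ι 1)
  have hg : LinearMap.ker f ≤ LinearMap.ker g := fun a ha => by
    simpa [g] using smul_one_eq_zero ι (hker ha)
  obtain ⟨ψ, hψ⟩ := Module.Injective.out (R := R) ((LinearMap.ker f).liftQ f le_rfl)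
    (LinearMap.ker_eq_bot.1 (Submodule.ker_liftQ_eq_bot _ _ _ le_rfl)) ((LinearMap.ker f).liftQ g hg)
  refine ⟨ψ, ?_⟩
  have := hψ (Submodule.Quotient.mk 1)
  simp only [Submodule.liftQ_apply, f, g, LinearMap.toSpanSingleton_apply, one_smul] at this
  rw [this]
  exact hι.one_ne_zero

theorem eq_zero_of_forall_apply_eq_zero (hι : IsInjectiveHull ι) {x : X}
    (hx : ∀ ψ : X →ₗ[R] E, ψ x = 0) : x = 0 := by
  by_contra h
  obtain ⟨ψ, hψ⟩ := hι.exists_apply_ne_zero h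
  exact hψ (hx ψ)

theorem mem_of_forall_apply_eq_zero (hι : IsInjectiveHull ι) {N : Submodule R X} {x : X}
    (hx : ∀ ψ : X →ₗ[R] E, N ≤ LinearMap.ker ψ → ψ x = 0) : x ∈ N := by
  rw [← Submodule.Quotient.mk_eq_zero]
  refine hι.eq_zero_of_forall_apply_eq_zero fun ψ => hx (ψ ∘ₗ N.mkQ) ?_
  intro y hy
  simp [(Submodule.Quotient.mk_eq_zero N).2 hy]

theorem bidualityMap_injective (hι : IsInjectiveHull ι) :
    Function.Injective (bidualityMap R X E) := by
  rw [← LinearMap.ker_eq_bot, LinearMap.ker_eq_bot']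
  exact fun x hx => hι.eq_zero_of_forall_apply_eq_zero fun ψ => LinearMap.congr_fun hx ψ

/-- All values of functionals on `X` and on its dual lie in the socle of `E`. Hence `ψ₀` spans the
dual, and `φ` is determined by comparing `φ ψ₀ = b • ι 1` with `ψ₀ x = c • ι 1`. -/
theorem bidualityMap_surjective_of_isSimpleModule (hι : IsInjectiveHull ι) [IsSimpleModule R X] :
    Function.Surjective (bidualityMap R X E) := by
  have hm : ∀ a ∈ maximalIdeal R, ∀ x : X, a • x = 0 := by
    have hmax := IsSimpleModule.annihilator_isMaximal (R := R) (M := X)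
    rw [← eq_maximalIdeal hmax]
    exact fun a ha x => Module.mem_annihilator.1 ha x
  have := IsSimpleModule.nontrivial R X
  obtain ⟨x, hx⟩ := exists_ne (0 : X)
  obtain ⟨ψ₀, hψ₀⟩ := hι.exists_apply_ne_zero hx
  have hsoc : ∀ e : (X →ₗ[R] E) →ₗ[R] E, ∀ ψ, ∃ b : R, e ψ = b • ι 1 := fun e ψ =>
    hι.exists_eq_smul_one fun a ha => by
      rw [← map_smul, show a • ψ = 0 from LinearMap.ext fun y => by
        rw [LinearMap.smul_apply, ← map_smul, hm a ha, map_zero]; rfl, map_zero]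
  have hval : ∀ ψ : X →ₗ[R] E, ∃ b : R, ψ x = b • ι 1 := fun ψ =>
    hsoc (bidualityMap R X E x) ψ
  obtain ⟨c, hc⟩ := hval ψ₀
  have hcu : IsUnit c := by
    by_contra hcon
    exact hψ₀ (by rw [hc, smul_one_eq_zero ι hcon])
  obtain ⟨c, rfl⟩ := hcu
  have hone : ι 1 = ((c⁻¹ : Rˣ) : R) • ψ₀ x := by rw [hc, smul_smul]; simp
  intro φ
  obtain ⟨b, hb⟩ := hsoc φ ψ₀
  refine ⟨(b * ((c⁻¹ : Rˣ) : R)) • x, LinearMap.ext fun ψ => ?_⟩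
  obtain ⟨a, ha⟩ := hval ψ
  have hψ : ψ = (a * ((c⁻¹ : Rˣ) : R)) • ψ₀ := by
    ext y
    obtain ⟨t, rfl⟩ := IsSimpleModule.toSpanSingleton_surjective R hx y
    simp [ha, hone, mul_smul]
  change ψ _ = φ ψ
  rw [hψ, map_smul φ, hb, hone]
  simp only [LinearMap.smul_apply, map_smul, smul_smul]
  congr 1
  ring

/-- On functionals vanishing on `N`, `φ` is evaluation at some `x`. The difference of `φ` and
evaluation at `x` then descends to the dual of `N`, where it is evaluation at some `y`; so `φ` is
evaluation at `x + y`. -/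
theorem bidualityMap_surjective_of_quotient (hι : IsInjectiveHull ι) (N : Submodule R X)
    (h₁ : Function.Surjective (bidualityMap R N E))
    (h₂ : Function.Surjective (bidualityMap R (X ⧸ N) E)) :
    Function.Surjective (bidualityMap R X E) := by
  have := hι.injective_module
  intro φ
  obtain ⟨z, hz⟩ := h₂ (φ ∘ₗ LinearMap.lcomp R E N.mkQ)
  obtain ⟨x, rfl⟩ := N.mkQ_surjective z
  have hx : ∀ ψ : X →ₗ[R] E, N ≤ LinearMap.ker ψ → φ ψ = ψ x := by
    intro ψ hψ
    have := LinearMap.congr_fun hz (N.liftQ ψ hψ)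
    have h2 : N.liftQ ψ hψ ∘ₗ N.mkQ = ψ := N.liftQ_mkQ ψ hψ
    change N.liftQ ψ hψ (N.mkQ x) = φ (N.liftQ ψ hψ ∘ₗ N.mkQ) at this
    rw [h2] at this
    rw [← this]
    rfl
  let res : (X →ₗ[R] E) →ₗ[R] (N →ₗ[R] E) := LinearMap.lcomp R E N.subtype
  have hres : Function.Surjective res := fun f => by
    obtain ⟨h, hh⟩ := Module.Injective.out (R := R) N.subtype N.subtype_injective f
    exact ⟨h, LinearMap.ext hh⟩
  have hker : LinearMap.ker res ≤ LinearMap.ker (φ - bidualityMap R X E x) := by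
    intro ψ hψ
    have hψ' : N ≤ LinearMap.ker ψ := fun y hy => LinearMap.congr_fun hψ ⟨y, hy⟩
    change φ ψ - ψ x = 0
    rw [hx ψ hψ', sub_self]
  let φ'' : (N →ₗ[R] E) →ₗ[R] E := (LinearMap.ker res).liftQ (φ - bidualityMap R X E x) hker ∘ₗ
    (res.quotKerEquivOfSurjective hres).symm.toLinearMap
  have hφ'' : ∀ ψ, φ'' (res ψ) = φ ψ - ψ x := by
    intro ψ
    have : (res.quotKerEquivOfSurjective hres).symm (res ψ) = Submodule.Quotient.mk ψ := by
      rw [LinearEquiv.symm_apply_eq]; rfl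
    simp only [φ'', LinearMap.comp_apply, LinearEquiv.coe_coe, this]
    rfl
  obtain ⟨y, hy⟩ := h₁ φ''
  refine ⟨x + y, LinearMap.ext fun ψ => ?_⟩
  have := hφ'' ψ
  rw [← hy] at this
  change ψ y = φ ψ - ψ x at this
  change ψ (x + y) = φ ψ
  rw [map_add, this]
  abel

theorem bidualityMap_bijective_of_isFiniteLength (hι : IsInjectiveHull ι)
    (h : IsFiniteLength R X) : Function.Bijective (bidualityMap R X E) := by
  refine ⟨hι.bidualityMap_injective, ?_⟩
  induction h with
  | of_subsingleton =>
    intro φ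
    refine ⟨0, LinearMap.ext fun ψ => ?_⟩
    rw [Subsingleton.elim ψ 0, map_zero, map_zero]
  | @of_simple_quotient M _ _ N _ _ ih =>
    exact hι.bidualityMap_surjective_of_quotient N ih hι.bidualityMap_surjective_of_isSimpleModule

end IsInjectiveHull

/-- A nonzero element killed by a power of an ideal has a nonzero multiple killed by the ideal. -/
theorem exists_smul_ne_zero_of_pow_smul_eq_zero {R M : Type*} [CommRing R] [AddCommGroup M]
    [Module R M] {𝔞 : Ideal R} {x : M} (hx : x ≠ 0) (n : ℕ) (h : ∀ a ∈ 𝔞 ^ n, a • x = 0) :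
    ∃ b : R, b • x ≠ 0 ∧ ∀ a ∈ 𝔞, a • b • x = 0 := by
  induction n with
  | zero => exact absurd (by simpa using h 1 (by simp)) hx
  | succ n ih =>
    by_cases hn : ∀ b ∈ 𝔞 ^ n, b • x = 0
    · exact ih hn
    · push Not at hn
      obtain ⟨b, hb, hbx⟩ := hn
      exact ⟨b, hbx, fun a ha => by
        rw [smul_smul]; exact h _ (by rw [pow_succ']; exact Ideal.mul_mem_mul ha hb)⟩

/-- A noetherian module killed by a power of the maximal ideal of a local ring has finite length. -/
theorem isFiniteLength_of_maximalIdeal_pow_smul_eq_zero {X : Type u} [AddCommGroup X] [Module R X]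
    [IsNoetherian R X] (n : ℕ) (h : ∀ a ∈ maximalIdeal R ^ n, ∀ x : X, a • x = 0) :
    IsFiniteLength R X := by
  obtain ⟨N, hN, hmax⟩ := set_has_maximal_iff_noetherian.2 (inferInstanceAs (IsNoetherian R X))
    {N : Submodule R X | IsFiniteLength R N} ⟨⊥, IsFiniteLength.of_subsingleton⟩
  suffices hN' : N = ⊤ by
    rw [hN'] at hN
    exact Submodule.topEquiv.isFiniteLength hN
  by_contra hne
  obtain ⟨x, -, hxN⟩ := SetLike.exists_of_lt (lt_top_iff_ne_top.2 hne)
  -- A nonzero element of `X ⧸ N` has a nonzero multiple killed by the maximal ideal; adjoining a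
  -- lift `y` enlarges `N` by a simple quotient.
  obtain ⟨b, hb, hann⟩ := exists_smul_ne_zero_of_pow_smul_eq_zero (x := N.mkQ x)
    (fun h0 => hxN ((Submodule.Quotient.mk_eq_zero N).1 h0)) n fun a ha => by
      rw [← map_smul, h a ha, map_zero]
  set y := b • x
  have hx : y ∉ N := fun hy => hb (by
    rw [← map_smul]; exact (Submodule.Quotient.mk_eq_zero N).2 hy)
  have hy : ∀ a ∈ maximalIdeal R, a • y ∈ N := fun a ha =>
    (Submodule.Quotient.mk_eq_zero N).1 (hann a ha)
  let N' := N ⊔ Submodule.span R {y}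
  have hlt : N < N' := lt_of_le_of_ne le_sup_left fun h => hx (by
    rw [h]; exact Submodule.mem_sup_right (Submodule.mem_span_singleton_self y))
  refine hmax N' ?_ hlt
  have hsimple : IsSimpleModule R (N' ⧸ N.submoduleOf N') := by
    let f : R →ₗ[R] N' ⧸ N.submoduleOf N' :=
      (N.submoduleOf N').mkQ ∘ₗ LinearMap.toSpanSingleton R N'
        ⟨y, Submodule.mem_sup_right (Submodule.mem_span_singleton_self y)⟩
    have hf : Function.Surjective f := by
      intro z
      obtain ⟨⟨z, hz⟩, rfl⟩ := Submodule.mkQ_surjective _ z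
      obtain ⟨p, hp, q, hq, rfl⟩ := Submodule.mem_sup.1 hz
      obtain ⟨t, rfl⟩ := Submodule.mem_span_singleton.1 hq
      refine ⟨t, (Submodule.Quotient.eq _).2 ?_⟩
      change t • y - (p + t • y) ∈ N
      simpa using hp
    have hk : LinearMap.ker f = maximalIdeal R := by
      refine (eq_maximalIdeal (Ideal.isMaximal_def.2 ⟨?_, ?_⟩))
      · intro htop
        have : (1 : R) ∈ LinearMap.ker f := by rw [htop]; trivial
        have h1 : (1 : R) • y ∈ N := (Submodule.Quotient.mk_eq_zero (N.submoduleOf N')).1 this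
        exact hx (by simpa using h1)
      · intro P hP
        by_contra hPt
        refine hP.not_ge ((le_maximalIdeal hPt).trans fun a ha => ?_)
        exact (Submodule.Quotient.mk_eq_zero _).2 (hy a ha)
    have e := f.quotKerEquivOfSurjective hf
    rw [hk] at e
    have : IsSimpleModule R (R ⧸ maximalIdeal R) :=
      isSimpleModule_iff_isCoatom.2 (Ideal.isMaximal_def.1 inferInstance)
    exact IsSimpleModule.congr e.symm
  refine @IsFiniteLength.of_simple_quotient R _ N' _ _ (N.submoduleOf N') hsimple ?_
  exact (Submodule.submoduleOfEquivOfLe hlt.le).symm.isFiniteLength hN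

end LocalDuality

/-! ### Transfer of the noetherian condition between rings of scalars -/

section ChangeOfScalars

variable {S S' M N : Type*} [Ring S] [Ring S'] [AddCommGroup M] [Module S' M]
  [AddCommGroup N] [Module S N]

/-- Pulling back submodules along a surjection that carries the action of each scalar in `S'` to
the action of some scalar in `S`. -/
def Submodule.pullbackScalars (σ : M →+ N) (h : ∀ s : S', ∃ t : S, ∀ x, σ (s • x) = t • σ x)
    (P : Submodule S N) : Submodule S' M where
  carrier := {x | σ x ∈ P}
  add_mem' hx hy := by simpa using P.add_mem hx hy
  zero_mem' := by simp
  smul_mem' s x hx := by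
    obtain ⟨t, ht⟩ := h s
    change σ (s • x) ∈ P
    rw [ht]
    exact P.smul_mem t hx

theorem Submodule.pullbackScalars_strictMono (σ : M →+ N) (hσ : Function.Surjective σ)
    (h : ∀ s : S', ∃ t : S, ∀ x, σ (s • x) = t • σ x) :
    StrictMono (Submodule.pullbackScalars σ h) := by
  refine Monotone.strictMono_of_injective (fun P Q hPQ x hx => hPQ hx) fun P Q hPQ => ?_
  ext y
  obtain ⟨x, rfl⟩ := hσ y
  exact SetLike.ext_iff.1 hPQ x

theorem IsNoetherian.of_surjective_of_forall_exists_smul (σ : M →+ N)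
    (hσ : Function.Surjective σ) (h : ∀ s : S', ∃ t : S, ∀ x, σ (s • x) = t • σ x)
    [IsNoetherian S' M] : IsNoetherian S N :=
  isNoetherian_iff'.2 (Submodule.pullbackScalars_strictMono σ hσ h).wellFoundedGT

/-- Every `S`-submodule is an `S'`-submodule. This is tested element by element, so `t` may depend
on `x`. -/
theorem IsNoetherian.of_forall_exists_smul_eq [Module S M]
    (h : ∀ (s : S') (x : M), ∃ t : S, s • x = t • x) [IsNoetherian S' M] : IsNoetherian S M := by
  let f (P : Submodule S M) : Submodule S' M :=
    { P with
      smul_mem' := fun s x hx => by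
        obtain ⟨t, ht⟩ := h s x
        rw [ht]
        exact P.smul_mem t hx }
  have hf : StrictMono f := Monotone.strictMono_of_injective (fun P Q hPQ x hx => hPQ hx)
    fun P Q hPQ => SetLike.ext fun x => SetLike.ext_iff.1 hPQ x
  exact isNoetherian_iff'.2 hf.wellFoundedGT

end ChangeOfScalars

/-! ### Duals of artinian modules over the endomorphism ring -/

section EndomorphismAction

variable {R : Type u} [CommRing R] {X E : Type u} [AddCommGroup X] [Module R X]
  [AddCommGroup E] [Module R E]

/-- The intersection of the kernels of a family of functionals on an artinian module is already
the intersection of finitely many of them. -/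
theorem IsArtinian.exists_finset_forall_apply_eq_zero {R X E : Type*} [Ring R] [AddCommGroup X]
    [Module R X] [AddCommGroup E] [Module R E] [IsArtinian R X] {κ : Type*}
    (ψ : κ → (X →ₗ[R] E)) :
    ∃ t : Finset κ, ∀ x, (∀ j ∈ t, ψ j x = 0) → ∀ i, ψ i x = 0 := by
  classical
  obtain ⟨_, ⟨t, rfl⟩, ht⟩ := IsArtinian.set_has_minimal (R := R) (M := X)
    (Set.range fun t : Finset κ => t.inf fun j => LinearMap.ker (ψ j)) ⟨_, ∅, rfl⟩
  refine ⟨t, fun x hx i => ?_⟩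
  have hle : (insert i t).inf (fun j => LinearMap.ker (ψ j)) ≤
      t.inf fun j => LinearMap.ker (ψ j) := Finset.inf_mono (Finset.subset_insert i t)
  have heq := eq_of_le_of_not_lt hle (ht _ ⟨_, rfl⟩)
  have hxt : x ∈ t.inf fun j => LinearMap.ker (ψ j) := by
    rw [Submodule.mem_finsetInf]
    exact hx
  rw [← heq, Submodule.mem_finsetInf] at hxt
  exact hxt i (Finset.mem_insert_self i t)

/-- The dual of an artinian module with respect to an injective module `E` is noetherian over the
endomorphism ring of `E`. -/
theorem isNoetherian_end_dual [Module.Injective R E] [IsArtinian R X] :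
    IsNoetherian (Module.End R E) (X →ₗ[R] E) := by
  classical
  refine ⟨fun S => ?_⟩
  obtain ⟨t, ht⟩ := IsArtinian.exists_finset_forall_apply_eq_zero
    (fun f : S => (f : X →ₗ[R] E))
  refine ⟨t.map (Function.Embedding.subtype _), le_antisymm (Submodule.span_le.2 ?_) fun g hg => ?_⟩
  · intro f hf
    simp only [Finset.coe_map, Set.mem_image] at hf
    obtain ⟨f, -, rfl⟩ := hf
    exact f.2
  -- Since `g` vanishes on `ker F`, it factors through the image of `F`; an extension `h` to the
  -- finite power of `E` has components that are the coefficients of `g`.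
  let F : X →ₗ[R] (t → E) := LinearMap.pi fun f => ((f : S) : X →ₗ[R] E)
  have hker : LinearMap.ker F ≤ LinearMap.ker g := fun x hx =>
    ht x (fun f hf => congrFun hx ⟨f, hf⟩) ⟨g, hg⟩
  obtain ⟨h, hh⟩ := Module.Injective.out (R := R) ((LinearMap.ker F).liftQ F le_rfl)
    (LinearMap.ker_eq_bot.1 (Submodule.ker_liftQ_eq_bot _ _ _ le_rfl)) ((LinearMap.ker F).liftQ g hker)
  have hg' : g = ∑ f : t, (h ∘ₗ LinearMap.single R (fun _ => E) f : Module.End R E) •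
      ((f : S) : X →ₗ[R] E) := by
    ext x
    have h1 : h (F x) = g x := hh (Submodule.Quotient.mk x)
    rw [← h1, LinearMap.sum_apply]
    conv_lhs => rw [← Finset.univ_sum_single (F x), map_sum]
    rfl
  rw [hg']
  refine Submodule.sum_mem _ fun f _ => Submodule.smul_mem _ _ (Submodule.subset_span ?_)
  simp

end EndomorphismAction

/-! ### Endomorphisms of the injective hull as limits of scalars -/

section EndomorphismsOfHull

variable {R E : Type u} [CommRing R] [IsLocalRing R] [AddCommGroup E] [Module R E]
  {ι : ResidueField R →ₗ[R] E}

namespace IsInjectiveHull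

/-- Elements of `E` killed by `𝔞` are maps `R ⧸ 𝔞 → E`, so `h` induces a functional on the dual of
`R ⧸ 𝔞`. By reflexivity it is evaluation at the class of some `a`. -/
theorem exists_end_apply_eq_smul (hι : IsInjectiveHull ι) (h : E →ₗ[R] E) (𝔞 : Ideal R)
    (h𝔞 : IsFiniteLength R (R ⧸ 𝔞)) : ∃ a : R, ∀ e : E, (∀ b ∈ 𝔞, b • e = 0) → h e = a • e := by
  let φ : ((R ⧸ 𝔞) →ₗ[R] E) →ₗ[R] E := h ∘ₗ LinearMap.applyₗ (Submodule.Quotient.mk 1)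
  obtain ⟨z, hz⟩ := (hι.bidualityMap_bijective_of_isFiniteLength h𝔞).2 φ
  obtain ⟨a, rfl⟩ := Submodule.mkQ_surjective _ z
  refine ⟨a, fun e he => ?_⟩
  have := LinearMap.congr_fun hz (Submodule.liftQ 𝔞 (LinearMap.toSpanSingleton R E e) he)
  have h1 : a • e = h ((1 : R) • e) := this
  rw [h1, one_smul]

/-- Coherence is automatic: `a i` and `a j` both describe `h` on the `𝔞 i`-torsion, so every
functional vanishing on `𝔞 i` vanishes at `a i - a j`. -/
theorem exists_end_apply_eq_smul_of_antitone (hι : IsInjectiveHull ι) (h : E →ₗ[R] E)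
    (𝔞 : ℕ → Ideal R) (hanti : Antitone 𝔞) (h𝔞 : ∀ j, IsFiniteLength R (R ⧸ 𝔞 j)) :
    ∃ a : ℕ → R, (∀ j, ∀ e : E, (∀ b ∈ 𝔞 j, b • e = 0) → h e = a j • e) ∧
      ∀ i j, i ≤ j → a i - a j ∈ 𝔞 i := by
  choose a ha using fun j => hι.exists_end_apply_eq_smul h (𝔞 j) (h𝔞 j)
  refine ⟨a, ha, fun i j hij => ?_⟩
  refine hι.mem_of_forall_apply_eq_zero fun ψ hψ => ?_
  have hi : ∀ b ∈ 𝔞 i, b • ψ 1 = 0 := fun b hb => by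
    rw [← map_smul, smul_eq_mul, mul_one]
    exact hψ hb
  have := (ha i _ hi).symm.trans (ha j _ fun b hb => hi b (hanti hij hb))
  rw [← mul_one (a i - a j), ← smul_eq_mul, map_smul, sub_smul, this, sub_self]

end IsInjectiveHull

theorem isFiniteLength_quotient_of_maximalIdeal_pow_le [IsNoetherianRing R] (𝔞 : Ideal R) (n : ℕ)
    (h : maximalIdeal R ^ n ≤ 𝔞) : IsFiniteLength R (R ⧸ 𝔞) :=
  isFiniteLength_of_maximalIdeal_pow_smul_eq_zero n fun a ha x => by
    obtain ⟨y, rfl⟩ := Submodule.mkQ_surjective _ x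
    rw [← map_smul]
    exact (Submodule.Quotient.mk_eq_zero _).2 (𝔞.mul_mem_right y (h ha))

end EndomorphismsOfHull

/-! ### Linear maps out of an artinian module, over the completion -/

section CompletionActionOnHom

variable {R A : Type u} [CommRing R] [IsNoetherianRing R] [IsLocalRing R]
  [AddCommGroup A] [Module R A] [IsArtinian R A]

/-- The completion acts on the linear maps from an artinian module through its action on that
module. -/
noncomputable abbrev homCompletionModule (Q : Type u) [AddCommGroup Q] [Module R Q] :
    Module (MCompletion R) (A →ₗ[R] Q) where
  smul r f := f ∘ₗ completionEnd A r
  one_smul f := by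
    change f ∘ₗ completionEnd A 1 = f
    rw [completionEnd_one, LinearMap.comp_id]
  mul_smul r s f := by
    change f ∘ₗ completionEnd A (r * s) = (f ∘ₗ completionEnd A s) ∘ₗ completionEnd A r
    rw [mul_comm, completionEnd_mul, LinearMap.comp_assoc]
  smul_zero r := LinearMap.zero_comp _
  smul_add r f g := LinearMap.add_comp _ _ _
  add_smul r s f := by
    change f ∘ₗ completionEnd A (r + s) = f ∘ₗ completionEnd A r + f ∘ₗ completionEnd A s
    rw [completionEnd_add, LinearMap.comp_add]
  zero_smul f := by
    change f ∘ₗ completionEnd A 0 = 0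
    rw [completionEnd_zero, LinearMap.comp_zero]

attribute [local instance] homCompletionModule

/-- An endomorphism `h` of `E` acts on the torsion of each power of the maximal ideal by a scalar.
These scalars form an element of the completion, which acts on `f` as `h` does because values of `f`
are torsion. -/
theorem IsInjectiveHull.isNoetherian_completion_dual {E : Type u} [AddCommGroup E] [Module R E]
    {ι : ResidueField R →ₗ[R] E} (hι : IsInjectiveHull ι) :
    IsNoetherian (MCompletion R) (A →ₗ[R] E) := by
  have := hι.injective_module
  have := isNoetherian_end_dual (R := R) (X := A) (E := E)
  refine IsNoetherian.of_forall_exists_smul_eq (S' := Module.End R E) fun h f => ?_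
  obtain ⟨a, ha, hcauchy⟩ := hι.exists_end_apply_eq_smul_of_antitone h (fun j => maximalIdeal R ^ j)
    (fun i j hij => Ideal.pow_le_pow_right hij)
    fun j => isFiniteLength_quotient_of_maximalIdeal_pow_le _ j le_rfl
  let s : AdicCompletion.AdicCauchySequence (maximalIdeal R) R :=
    AdicCompletion.AdicCauchySequence.mk _ R a fun n => by
      rw [SModEq.sub_mem]
      simpa using hcauchy n (n + 1) n.le_succ
  refine ⟨AdicCompletion.mk _ R s, LinearMap.ext fun x => ?_⟩
  obtain ⟨n, hn⟩ := exists_maximalIdeal_pow_smul_eq_zero (R := R) x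
  change h (f x) = f (completionEnd A _ x)
  rw [completionEnd_apply_eq _ x n hn (a n) (AdicCompletion.evalₐ_mk _ _ _), map_smul]
  exact ha n _ fun b hb => by rw [← map_smul, hn b hb, map_zero]

/-- If `Q` has artinian socle, then for artinian `A` the module of linear maps from `A` to `Q` is
noetherian over the completion. -/
theorem isNoetherian_completion_hom {Q : Type u} [AddCommGroup Q] [Module R Q]
    [IsArtinian R (ResidueField R →ₗ[R] Q)] : IsNoetherian (MCompletion R) (A →ₗ[R] Q) := by
  obtain ⟨E, _, _, ι, hι⟩ := exists_isInjectiveHull R (ResidueField R)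
  have := hι.injective_module
  -- `V` is the socle of `Q`, a quotient of `Hom(k, Q)` by evaluation at `1`, hence artinian.
  let V : Submodule R Q :=
    { carrier := {x | ∀ a ∈ maximalIdeal R, a • x = 0}
      add_mem' := fun hx hy a ha => by rw [smul_add, hx a ha, hy a ha, add_zero]
      zero_mem' := fun a _ => smul_zero a
      smul_mem' := fun c x hx a ha => by rw [smul_comm, hx a ha, smul_zero] }
  let ev : (ResidueField R →ₗ[R] Q) →ₗ[R] V :=
    (LinearMap.applyₗ (1 : ResidueField R)).codRestrict V fun f a ha => by
      change a • f 1 = 0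
      rw [← map_smul, Algebra.smul_def, mul_one]
      rw [show algebraMap R (ResidueField R) a = 0 from (residue_eq_zero_iff a).2 ha, map_zero]
  have hev : Function.Surjective ev := fun x =>
    ⟨Submodule.liftQ (maximalIdeal R) (LinearMap.toSpanSingleton R Q (x : Q)) x.2,
      Subtype.ext (one_smul R (x : Q))⟩
  have := isArtinian_of_surjective _ ev hev
  obtain ⟨t, ht⟩ := IsArtinian.exists_finset_forall_apply_eq_zero
    (fun ψ : Q →ₗ[R] E => ψ ∘ₗ V.subtype)
  have := hι.isNoetherian_completion_dual (A := A)
  let Φ : (A →ₗ[R] Q) →ₗ[MCompletion R] (t → (A →ₗ[R] E)) :=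
    { toFun := fun f ψ => (ψ : Q →ₗ[R] E) ∘ₗ f
      map_add' := fun f g => funext fun ψ => LinearMap.comp_add _ _ _
      map_smul' := fun r f => rfl }
  refine isNoetherian_of_injective Φ ?_
  rw [← LinearMap.ker_eq_bot, LinearMap.ker_eq_bot']
  intro f hf
  ext x
  by_contra hx
  obtain ⟨n, hn⟩ := exists_maximalIdeal_pow_smul_eq_zero (R := R) x
  -- Values of `f` are torsion, so a nonzero one has a nonzero multiple in the socle, where the
  -- functionals in `t` detect it.
  obtain ⟨b, hb, hann⟩ := exists_smul_ne_zero_of_pow_smul_eq_zero (x := f x) hx n fun a ha => by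
    rw [← map_smul, hn a ha, map_zero]
  refine hb (hι.eq_zero_of_forall_apply_eq_zero fun ψ => ?_)
  refine ht ⟨b • f x, hann⟩ (fun j hj => ?_) ψ
  have := LinearMap.congr_fun (congrFun hf ⟨j, hj⟩) (b • x)
  simpa [Φ] using this

end CompletionActionOnHom

/-! ### Descent from the completion to the base ring -/

/-- The image of `r` in the completion of `R ⧸ J` comes from some `a`. By exactness of completion
the difference comes from the completion of `J`, which is the image of the completion of `R`
tensored with `J`. -/
theorem AdicCompletion.exists_sub_algebraMap_mem_map {R : Type u} [CommRing R] [IsNoetherianRing R]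
    (I J : Ideal R) [IsPrecomplete I (R ⧸ J)] (r : AdicCompletion I R) :
    ∃ a : R, r - algebraMap R _ a ∈ J.map (algebraMap R (AdicCompletion I R)) := by
  obtain ⟨z, hz⟩ := AdicCompletion.of_surjective I (R ⧸ J) (AdicCompletion.map I J.mkQ r)
  obtain ⟨a, rfl⟩ := Submodule.mkQ_surjective _ z
  refine ⟨a, ?_⟩
  have hker : AdicCompletion.map I J.mkQ (r - algebraMap R _ a) = 0 := by
    rw [map_sub, AdicCompletion.algebraMap_apply, Algebra.algebraMap_self, RingHom.id_apply,
      AdicCompletion.map_of, hz, sub_self]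
  obtain ⟨w, hw⟩ := (AdicCompletion.map_exact (I := I) (f := Submodule.subtype J)
    (Submodule.subtype_injective J) (LinearMap.exact_subtype_mkQ J)
    (Submodule.mkQ_surjective J) _).1 hker
  obtain ⟨v, rfl⟩ := AdicCompletion.ofTensorProduct_surjective_of_finite I J w
  have key : LinearMap.range (AdicCompletion.map I (Submodule.subtype J) ∘ₗ
      AdicCompletion.ofTensorProduct I J) ≤ J.map (algebraMap R (AdicCompletion I R)) := by
    rintro _ ⟨v, rfl⟩
    induction v with
    | zero => rw [LinearMap.map_zero]; exact Submodule.zero_mem _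
    | add x y hx hy => rw [LinearMap.map_add]; exact Submodule.add_mem _ hx hy
    | tmul s j =>
      rw [LinearMap.comp_apply, AdicCompletion.ofTensorProduct_tmul, LinearMap.map_smul,
        AdicCompletion.map_of]
      exact Ideal.mul_mem_left _ s (Ideal.mem_map_of_mem _ j.2)
  rw [← hw]
  exact key ⟨v, rfl⟩

section Cokernel

variable {R A : Type u} [CommRing R] [IsNoetherianRing R] [IsLocalRing R]
  [AddCommGroup A] [Module R A] [IsArtinian R A]

theorem map_comp_completionEnd_eq_zero {Z Y : Type u} [AddCommGroup Z] [Module R Z]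
    [AddCommGroup Y] [Module R Y] (ρ : (A →ₗ[R] Z) →ₗ[R] Y) (J : Ideal R)
    (hJ : ∀ a ∈ J, ∀ y : Y, a • y = 0) {r : MCompletion R}
    (hr : r ∈ J.map (algebraMap R (MCompletion R))) (f : A →ₗ[R] Z) :
    ρ (f ∘ₗ completionEnd A r) = 0 := by
  induction hr using Submodule.span_induction generalizing f with
  | mem r hr =>
    obtain ⟨a, ha, rfl⟩ := hr
    rw [completionEnd_algebraMap, LinearMap.comp_smul, LinearMap.comp_id, map_smul, hJ a ha]
  | zero => rw [completionEnd_zero, LinearMap.comp_zero, map_zero]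
  | add r s _ _ hr hs => rw [completionEnd_add, LinearMap.comp_add, map_add, hr, hs, add_zero]
  | smul s r _ hr => rw [smul_eq_mul, completionEnd_mul, ← LinearMap.comp_assoc, hr]

attribute [local instance] homCompletionModule

/-- Let `d : I → Z` be a linear map from an injective module such that the cokernel of
`Hom (k, I) → Hom (k, Z)` is artinian. If `A` is artinian, then every quotient of the cokernel of
`Hom (A, I) → Hom (A, Z)` that is killed by an ideal `J` with `R ⧸ J` complete is noetherian. -/
theorem isNoetherian_of_surjective_hom {I Z Yk Y : Type u} [AddCommGroup I] [Module R I]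
    [Module.Injective R I] [AddCommGroup Z] [Module R Z] [AddCommGroup Yk] [Module R Yk]
    [AddCommGroup Y] [Module R Y] (d : I →ₗ[R] Z)
    (ρk : (ResidueField R →ₗ[R] Z) →ₗ[R] Yk) (hρk : ∀ f, ρk f = 0 → ∃ g, d ∘ₗ g = f)
    [IsArtinian R Yk]
    (ρ : (A →ₗ[R] Z) →ₗ[R] Y) (hρ : Function.Surjective ρ) (hρd : ∀ g, ρ (d ∘ₗ g) = 0)
    (J : Ideal R) (hJ : ∀ a ∈ J, ∀ y : Y, a • y = 0) [IsPrecomplete (maximalIdeal R) (R ⧸ J)] :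
    IsNoetherian R Y := by
  -- `P` is injective and `d` is injective on it, so `d(P)` is a direct summand of `Z` with
  -- complement `Q = ker π`.
  obtain ⟨P, -, hP⟩ := Submodule.exists_le_maximal_disjoint (LinearMap.ker d) ⊥ disjoint_bot_left
  obtain ⟨p, hp⟩ := Module.Injective.exists_retraction_of_maximal_disjoint hP
  have := Module.Injective.of_retraction P.subtype p hp
  have hdP : Function.Injective (d ∘ₗ P.subtype) := by
    rw [← LinearMap.ker_eq_bot, LinearMap.ker_eq_bot']
    exact fun x hx => Subtype.ext (Submodule.disjoint_def.1 hP.prop x x.2 hx)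
  obtain ⟨π, hπ⟩ := Module.Injective.out (R := R) _ hdP LinearMap.id
  have hπ' : ∀ x : P, π (d x) = x := hπ
  let Q := LinearMap.ker π
  let θ : Z →ₗ[R] Q := (LinearMap.id - d ∘ₗ P.subtype ∘ₗ π).codRestrict Q fun z => by
    simp [Q, hπ']
  -- If `f : k → Q` lifts to `g : k → I`, the image of `g` lies in `P ⊔ ker d`, so `f` takes values
  -- in `d(P) ⊓ Q`, which is zero.
  have hk : Function.Injective (ρk ∘ₗ LinearMap.compRight R Q.subtype) := by
    rw [← LinearMap.ker_eq_bot, LinearMap.ker_eq_bot']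
    intro f hf
    obtain ⟨g, hg⟩ := hρk _ hf
    have hg' : ∀ x, d (g x) = f x := fun x => LinearMap.congr_fun hg x
    -- Otherwise, since the residue field is simple, `P ⊔ range g` would still be disjoint from `ker
    -- d`, and maximality of `P` would put `range g` inside `P`.
    have hPker : LinearMap.range g ≤ P ⊔ LinearMap.ker d ∨ g = 0 := by
      by_contra hcon
      push Not at hcon
      obtain ⟨hcon, hg0⟩ := hcon
      have hdisj : Disjoint (P ⊔ LinearMap.range g) (LinearMap.ker d) := by
        rw [Submodule.disjoint_def]
        intro x hx hxd
        obtain ⟨q, hq, γ, ⟨c, rfl⟩, rfl⟩ := Submodule.mem_sup.1 hx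
        have hc : g c ∈ P ⊔ LinearMap.ker d := by
          rw [show g c = -q + (q + g c) by abel]
          exact Submodule.add_mem_sup (P.neg_mem hq) hxd
        by_cases hc0 : c = 0
        · subst hc0
          rw [map_zero, add_zero] at hxd ⊢
          exact Submodule.disjoint_def.1 hP.prop q hq hxd
        · refine absurd ?_ hcon
          rintro _ ⟨y, rfl⟩
          obtain ⟨s, hs⟩ := residue_surjective (y * c⁻¹)
          have : y = s • c := by
            rw [Algebra.smul_def]
            change y = residue R s * c
            rw [hs, inv_mul_cancel_right₀ hc0]
          rw [this, map_smul]
          exact Submodule.smul_mem _ s hc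
      exact hcon ((le_sup_right.trans (hP.le_of_ge hdisj le_sup_left)).trans le_sup_left)
    ext x
    rcases hPker with h | rfl
    · obtain ⟨q, hq, κ, hκ, hsum⟩ := Submodule.mem_sup.1 (h ⟨x, rfl⟩)
      have hd : (f x : Z) = d q := by
        rw [← hg', ← hsum, map_add, LinearMap.mem_ker.1 hκ, add_zero]
      have hq0 : (⟨q, hq⟩ : P) = 0 := by
        rw [← hπ' ⟨q, hq⟩]
        change π (d q) = 0
        rw [← hd]
        exact (f x).2
      rw [hd, show q = 0 from congrArg Subtype.val hq0]
      simp
    · rw [← hg']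
      simp
  have := isArtinian_of_injective _ hk
  have := isNoetherian_completion_hom (R := R) (A := A) (Q := Q)
  let σ : (A →ₗ[R] Q) →ₗ[R] Y := ρ ∘ₗ LinearMap.compRight R Q.subtype
  refine IsNoetherian.of_surjective_of_forall_exists_smul (S' := MCompletion R) σ.toAddMonoidHom
    ?_ fun r => ?_
  · intro y
    obtain ⟨f, rfl⟩ := hρ y
    refine ⟨θ ∘ₗ f, ?_⟩
    -- The component of `f` in `d(P)` factors through `d`, so `ρ` kills it.
    have : f = Q.subtype ∘ₗ θ ∘ₗ f + d ∘ₗ (P.subtype ∘ₗ π ∘ₗ f) := by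
      ext x
      exact (sub_add_cancel (f x) (d (π (f x)))).symm
    conv_rhs => rw [this, map_add, hρd, add_zero]
    rfl
  · obtain ⟨a, ha⟩ := AdicCompletion.exists_sub_algebraMap_mem_map (maximalIdeal R) J r
    refine ⟨a, fun f => ?_⟩
    have := map_comp_completionEnd_eq_zero σ J hJ ha f
    change σ (f ∘ₗ completionEnd A r) = a • σ f
    rw [show r = (r - algebraMap R _ a) + algebraMap R _ a by ring, completionEnd_add,
      LinearMap.comp_add, map_add, this, zero_add, completionEnd_algebraMap, LinearMap.comp_smul,
      LinearMap.comp_id, map_smul]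

end Cokernel

/-! ### Ext as a cokernel of Hom functors -/

section ExtPresentation

open Abelian

/-- `Ext^i(-, L)` is the cokernel of `Hom (-, I) → Hom (-, Z)` for some map `I → Z` from an
injective module. -/
theorem exists_injective_presentation_ext_category {R : Type u} [CommRing R] (i : ℕ)
    (L : ModuleCat.{u} R) :
    ∃ (I Z : ModuleCat.{u} R) (_ : Injective I) (d : I ⟶ Z) (e : Ext Z L i), ∀ M : ModuleCat.{u} R,
      (∀ x : Ext M L i, ∃ f : M ⟶ Z, (Ext.mk₀ f).comp e (zero_add i) = x) ∧
      ∀ f : M ⟶ Z, (Ext.mk₀ f).comp e (zero_add i) = 0 ↔ ∃ g : M ⟶ I, g ≫ d = f := by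
  induction i generalizing L with
  | zero =>
    refine ⟨ModuleCat.of R PUnit, L, ?_, 0, Ext.mk₀ (𝟙 L), fun M => ⟨fun x => ?_, fun f => ?_⟩⟩
    · exact (ModuleCat.isZero_of_subsingleton _).injective
    · obtain ⟨f, rfl⟩ := (Ext.mk₀_bijective M L).2 x
      exact ⟨f, by simp⟩
    · rw [Ext.mk₀_comp_mk₀, Category.comp_id, Ext.mk₀_eq_zero_iff]
      exact ⟨fun h => ⟨0, by simp [h]⟩, fun ⟨g, hg⟩ => by rw [← hg, Limits.comp_zero]⟩
  | succ i ih =>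
    let S : ShortComplex (ModuleCat.{u} R) :=
      ShortComplex.mk (Injective.ι L) (Limits.cokernel.π (Injective.ι L))
        (Limits.cokernel.condition _)
    have hS : S.ShortExact :=
      { exact := ShortComplex.exact_of_g_is_cokernel _ (Limits.cokernelIsCokernel _) }
    have hinj : Injective S.X₂ := inferInstanceAs (Injective (Injective.under L))
    -- From degree 0 to 1 the connecting map is onto with kernel the image of `Hom(M, S.X₂)`, so the
    -- short exact sequence itself is the presentation. In higher degrees it is bijective and the
    -- presentation for `S.X₃` is reused.
    cases i with
    | zero =>
      refine ⟨S.X₂, S.X₃, hinj, S.g, hS.extClass, fun M => ⟨fun x => ?_, fun f => ?_⟩⟩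
      · obtain ⟨y, rfl⟩ := Ext.covariant_sequence_exact₁ M hS x (Ext.eq_zero_of_injective _) rfl
        obtain ⟨f, rfl⟩ := (Ext.mk₀_bijective M S.X₃).2 y
        exact ⟨f, rfl⟩
      · constructor
        · intro h
          obtain ⟨y, hy⟩ := Ext.covariant_sequence_exact₃ M hS _ (zero_add 1) h
          obtain ⟨g, rfl⟩ := (Ext.mk₀_bijective M S.X₂).2 y
          rw [Ext.mk₀_comp_mk₀] at hy
          exact ⟨g, (Ext.mk₀_bijective M S.X₃).1 hy⟩
        · rintro ⟨g, rfl⟩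
          rw [← Ext.mk₀_comp_mk₀, Ext.comp_assoc_of_second_deg_zero, hS.comp_extClass,
            Ext.comp_zero]
    | succ i =>
      obtain ⟨I, Z, hI, d, e, h⟩ := ih S.X₃
      refine ⟨I, Z, hI, d, e.comp hS.extClass rfl, fun M => ⟨fun x => ?_, fun f => ?_⟩⟩
      · obtain ⟨y, rfl⟩ := Ext.covariant_sequence_exact₁ M hS x (Ext.eq_zero_of_injective _) rfl
        obtain ⟨f, rfl⟩ := (h M).1 y
        exact ⟨f, (Ext.comp_assoc _ _ _ _ _ (by lia)).symm⟩
      · rw [← (h M).2 f, ← Ext.comp_assoc (a₁₂ := i + 1) _ _ _ (zero_add _) rfl (by lia)]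
        constructor
        · intro h0
          obtain ⟨y, hy⟩ := Ext.covariant_sequence_exact₃ M hS _ rfl h0
          rw [← hy, Ext.eq_zero_of_injective y, Ext.zero_comp]
        · intro h0
          rw [h0, Ext.zero_comp]

theorem exists_injective_presentation_ext {R : Type u} [CommRing R] (L : Type u) [AddCommGroup L]
    [Module R L] (i : ℕ) :
    ∃ (I Z : Type u) (_ : AddCommGroup I) (_ : Module R I) (_ : AddCommGroup Z) (_ : Module R Z)
      (_ : Module.Injective R I) (d : I →ₗ[R] Z), ∀ (M : Type u) [AddCommGroup M] [Module R M],
      ∃ ρ : (M →ₗ[R] Z) →ₗ[R] ExtMod R M L i, Function.Surjective ρ ∧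
        ∀ f, ρ f = 0 ↔ ∃ g, d ∘ₗ g = f := by
  obtain ⟨I, Z, hI, d, e, h⟩ := exists_injective_presentation_ext_category i (ModuleCat.of R L)
  refine ⟨I, Z, inferInstance, inferInstance, inferInstance, inferInstance,
    Module.injective_module_of_injective_object R I (inj := hI), d.hom, fun M _ _ => ?_⟩
  refine ⟨{ toFun := fun f => (Ext.mk₀ (ModuleCat.ofHom f)).comp e (zero_add i)
            map_add' := fun f g => by rw [ModuleCat.ofHom_add, Ext.mk₀_add, Ext.add_comp]
            map_smul' := fun a f => by
              rw [show ModuleCat.ofHom (a • f) = a • ModuleCat.ofHom f from rfl, Ext.mk₀_smul, Ext.smul_comp, RingHom.id_apply] }, ?_, ?_⟩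
  · intro x
    obtain ⟨f, hf⟩ := (h (ModuleCat.of R M)).1 x
    exact ⟨f.hom, hf⟩
  · intro f
    refine ((h (ModuleCat.of R M)).2 (ModuleCat.ofHom f)).trans ⟨?_, ?_⟩
    · rintro ⟨g, hg⟩
      exact ⟨g.hom, congrArg ModuleCat.Hom.hom hg⟩
    · rintro ⟨g, hg⟩
      exact ⟨ModuleCat.ofHom g, ModuleCat.hom_ext hg⟩

end ExtPresentation

/-! ### Duals of homology with respect to an injective module -/

section DualOfHomology

variable {R : Type u} [CommRing R]

/-- By adjunction, extending a map into `Hom(P, E)` means extending a map from a tensor product with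
`P` into `E`; flatness keeps the inclusion injective. -/
theorem Module.Injective.hom_of_flat (P E : Type u) [AddCommGroup P] [Module R P]
    [AddCommGroup E] [Module R E] [Module.Flat R P] [Module.Injective R E] :
    Module.Injective R (P →ₗ[R] E) where
  out X Y _ _ _ _ f hf g := by
    obtain ⟨h, hh⟩ := Module.Injective.out (R := R) (f.rTensor P)
      (Module.Flat.rTensor_preserves_injective_linearMap f hf) (TensorProduct.lift g)
    refine ⟨TensorProduct.curry h, fun x => LinearMap.ext fun p => ?_⟩
    simpa using hh (x ⊗ₜ[R] p)

/-- The dual of the homology of `B' → B → B''` with respect to an injective module. -/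
theorem exists_dual_homology {B' B B'' E : Type u} [AddCommGroup B'] [Module R B']
    [AddCommGroup B] [Module R B] [AddCommGroup B''] [Module R B''] [AddCommGroup E] [Module R E]
    [Module.Injective R E] (f : B' →ₗ[R] B) (g : B →ₗ[R] B'') (hfg : ∀ x, g (f x) = 0) :
    ∃ ρ : LinearMap.ker (LinearMap.lcomp R E f) →ₗ[R]
      ((LinearMap.ker g ⧸ LinearMap.range (f.codRestrict (LinearMap.ker g) hfg)) →ₗ[R] E),
      Function.Surjective ρ ∧ ∀ φ, ρ φ = 0 ↔ ∃ ψ : B'' →ₗ[R] E, ψ ∘ₗ g = φ := by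
  have hle : ∀ φ : LinearMap.ker (LinearMap.lcomp R E f),
      LinearMap.range (f.codRestrict (LinearMap.ker g) hfg) ≤
        LinearMap.ker ((φ : B →ₗ[R] E) ∘ₗ (LinearMap.ker g).subtype) := by
    rintro φ _ ⟨x, rfl⟩
    exact LinearMap.congr_fun φ.2 x
  refine ⟨{ toFun := fun φ => Submodule.liftQ _ _ (hle φ)
            map_add' := fun φ ψ => ?_
            map_smul' := fun a φ => ?_ }, ?_, ?_⟩
  · exact Submodule.linearMap_qext _ (LinearMap.ext fun x => rfl)
  · exact Submodule.linearMap_qext _ (LinearMap.ext fun x => rfl)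
  · intro χ
    obtain ⟨φ, hφ⟩ := Module.Injective.out (R := R) (LinearMap.ker g).subtype
      (Submodule.subtype_injective _) (χ ∘ₗ Submodule.mkQ _)
    refine ⟨⟨φ, LinearMap.ext fun x => ?_⟩, Submodule.linearMap_qext _ (LinearMap.ext hφ)⟩
    change φ (f x) = 0
    have h1 := hφ ⟨f x, hfg x⟩
    have h2 : (LinearMap.range (f.codRestrict (LinearMap.ker g) hfg)).mkQ ⟨f x, hfg x⟩ = 0 :=
      (Submodule.Quotient.mk_eq_zero _).2 ⟨x, rfl⟩
    rw [LinearMap.comp_apply, h2, map_zero] at h1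
    exact h1
  · intro φ
    constructor
    · intro h
      have hφ : LinearMap.ker g ≤ LinearMap.ker (φ : B →ₗ[R] E) := fun x hx =>
        LinearMap.congr_fun h (Submodule.Quotient.mk ⟨x, hx⟩)
      obtain ⟨ψ, hψ⟩ := Module.Injective.out (R := R) ((LinearMap.ker g).liftQ g le_rfl)
        (LinearMap.ker_eq_bot.1 (Submodule.ker_liftQ_eq_bot _ _ _ le_rfl))
        ((LinearMap.ker g).liftQ (φ : B →ₗ[R] E) hφ)
      exact ⟨ψ, LinearMap.ext fun x => hψ (Submodule.Quotient.mk x)⟩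
    · rintro ⟨ψ, hψ⟩
      refine Submodule.linearMap_qext _ (LinearMap.ext fun x => ?_)
      change (φ : B →ₗ[R] E) x = 0
      rw [← hψ, LinearMap.comp_apply, LinearMap.mem_ker.1 x.2, map_zero]

/-- By tensor-hom adjunction, functionals on `M ⊗ P` killing the image of `M ⊗ P'` are maps from `M`
to the functionals on `P` killing the image of `P'`. Thus `d` can be chosen independently of `M`. -/
theorem exists_dual_homology_lTensor {P' P P'' E : Type u} [AddCommGroup P'] [Module R P']
    [AddCommGroup P] [Module R P] [AddCommGroup P''] [Module R P''] [AddCommGroup E] [Module R E]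
    [Module.Injective R E] (f : P' →ₗ[R] P) (g : P →ₗ[R] P'') (hfg : g ∘ₗ f = 0) :
    ∃ d : (P'' →ₗ[R] E) →ₗ[R] LinearMap.ker (LinearMap.lcomp R E f),
      ∀ (M : Type u) [AddCommGroup M] [Module R M]
        (h : ∀ x, g.lTensor M (f.lTensor M x) = 0),
      ∃ ρ : (M →ₗ[R] LinearMap.ker (LinearMap.lcomp R E f)) →ₗ[R]
        ((LinearMap.ker (g.lTensor M) ⧸
          LinearMap.range ((f.lTensor M).codRestrict (LinearMap.ker (g.lTensor M)) h)) →ₗ[R] E),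
        Function.Surjective ρ ∧ ∀ F, ρ F = 0 ↔ ∃ G, d ∘ₗ G = F := by
  let Z := LinearMap.ker (LinearMap.lcomp R E f)
  refine ⟨(LinearMap.lcomp R E g).codRestrict Z fun ψ => ?_, fun M _ _ h => ?_⟩
  · change (ψ ∘ₗ g) ∘ₗ f = 0
    rw [LinearMap.comp_assoc, hfg, LinearMap.comp_zero]
  obtain ⟨ρ, hρ, hρ0⟩ := exists_dual_homology (E := E) _ _ h
  let u : (M →ₗ[R] Z) →ₗ[R] LinearMap.ker (LinearMap.lcomp R E (f.lTensor M)) :=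
    ((TensorProduct.lift.equiv (RingHom.id R) M P E).toLinearMap ∘ₗ
      LinearMap.compRight R Z.subtype).codRestrict _ fun F =>
        TensorProduct.ext' fun m p => LinearMap.congr_fun (F m).2 p
  refine ⟨ρ ∘ₗ u, hρ.comp fun φ => ?_, fun F => ?_⟩
  · refine ⟨(TensorProduct.curry φ.1).codRestrict Z fun m => LinearMap.ext fun p => ?_,
      Subtype.ext (TensorProduct.ext' fun m p => rfl)⟩
    exact LinearMap.congr_fun φ.2 (m ⊗ₜ p)
  · refine (hρ0 (u F)).trans ⟨?_, ?_⟩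
    · rintro ⟨ψ, hψ⟩
      exact ⟨TensorProduct.curry ψ, LinearMap.ext fun m => Subtype.ext (LinearMap.ext fun p =>
        LinearMap.congr_fun hψ (m ⊗ₜ p))⟩
    · rintro ⟨G, rfl⟩
      exact ⟨TensorProduct.lift G, TensorProduct.ext' fun m p => rfl⟩

end DualOfHomology

/-! ### The dual of Tor as a cokernel of Hom functors -/

section TorPresentation

variable {R : Type u} [CommRing R]

theorem nonempty_tor_equiv {L : Type u} [AddCommGroup L] [Module R L]
    (P : ProjectiveResolution (ModuleCat.of R L)) (M : Type u) [AddCommGroup M] [Module R M] (i : ℕ)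
    (h : ∀ x, (P.complex.sc i).g.hom.lTensor M ((P.complex.sc i).f.hom.lTensor M x) = 0) :
    Nonempty (TorMod R M L i ≃ₗ[R] (LinearMap.ker ((P.complex.sc i).g.hom.lTensor M) ⧸
      LinearMap.range (((P.complex.sc i).f.hom.lTensor M).codRestrict
        (LinearMap.ker ((P.complex.sc i).g.hom.lTensor M)) h))) := by
  let F := (MonoidalCategory.tensoringLeft (ModuleCat.{u} R)).obj (ModuleCat.of R M)
  let T := ((F.mapHomologicalComplex (ComplexShape.down ℕ)).obj P.complex).sc i
  exact ⟨(P.isoLeftDerivedObj F i ≪≫ T.moduleCatHomologyIso).toLinearEquiv⟩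

/-- The dual of `Tor_i(-, L)` with respect to an injective module is the cokernel of
`Hom (-, I) → Hom (-, Z)` for some map `I → Z` from an injective module. -/
theorem exists_injective_presentation_dual_tor (L E : Type u) [AddCommGroup L]
    [Module R L] [AddCommGroup E] [Module R E] [Module.Injective R E] (i : ℕ) :
    ∃ (I Z : Type u) (_ : AddCommGroup I) (_ : Module R I) (_ : AddCommGroup Z) (_ : Module R Z)
      (_ : Module.Injective R I) (d : I →ₗ[R] Z), ∀ (M : Type u) [AddCommGroup M] [Module R M],
      ∃ ρ : (M →ₗ[R] Z) →ₗ[R] (TorMod R M L i →ₗ[R] E), Function.Surjective ρ ∧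
        ∀ f, ρ f = 0 ↔ ∃ g, d ∘ₗ g = f := by
  let P := projectiveResolution (ModuleCat.of R L)
  let S := P.complex.sc i
  have hfg : S.g.hom ∘ₗ S.f.hom = 0 := congrArg ModuleCat.Hom.hom S.zero
  have : Module.Projective R S.X₃ := (IsProjective.iff_projective S.X₃).2 (P.projective _)
  obtain ⟨d, hd⟩ := exists_dual_homology_lTensor (E := E) S.f.hom S.g.hom hfg
  refine ⟨S.X₃ →ₗ[R] E, _, inferInstance, inferInstance, inferInstance, inferInstance,
    Module.Injective.hom_of_flat _ _, d, fun M _ _ => ?_⟩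
  have h : ∀ x, S.g.hom.lTensor M (S.f.hom.lTensor M x) = 0 := fun x => by
    rw [← LinearMap.comp_apply, ← LinearMap.lTensor_comp, hfg, LinearMap.lTensor_zero,
      LinearMap.zero_apply]
  obtain ⟨ρ, hρ, hρ0⟩ := hd M h
  obtain ⟨e⟩ := nonempty_tor_equiv P M i h
  refine ⟨LinearMap.lcomp R E e.toLinearMap ∘ₗ ρ, ?_, fun f => ?_⟩
  · intro χ
    obtain ⟨f, hf⟩ := hρ (χ ∘ₗ e.symm.toLinearMap)
    refine ⟨f, LinearMap.ext fun x => ?_⟩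
    rw [LinearMap.comp_apply, hf]
    simp
  · rw [← hρ0 f]
    constructor
    · intro h
      refine LinearMap.ext fun y => ?_
      have := LinearMap.congr_fun h (e.symm y)
      simpa using this
    · intro h
      rw [LinearMap.comp_apply, h, map_zero]

end TorPresentation

/-! ### Scalar actions on Ext and Tor -/

section ScalarActions

open Abelian

variable {R : Type u} [CommRing R]

theorem extMod_smul_eq_zero {A L : Type u} [AddCommGroup A] [Module R A] [AddCommGroup L]
    [Module R L] {i : ℕ} {a : R} (ha : a ∈ Module.annihilator R A ⊔ Module.annihilator R L)
    (x : ExtMod R A L i) : a • x = 0 := by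
  obtain ⟨b, hb, c, hc, rfl⟩ := Submodule.mem_sup.1 ha
  have hb' : b • 𝟙 (ModuleCat.of R A) = 0 :=
    ModuleCat.hom_ext (LinearMap.ext fun y => Module.mem_annihilator.1 hb y)
  have hc' : c • 𝟙 (ModuleCat.of R L) = 0 :=
    ModuleCat.hom_ext (LinearMap.ext fun y => Module.mem_annihilator.1 hc y)
  have h1 : b • x = 0 := by
    conv_lhs => rw [← Ext.mk₀_id_comp x]
    rw [← Ext.smul_comp, ← Ext.mk₀_smul, hb', Ext.mk₀_zero, Ext.zero_comp]
  have h2 : c • x = 0 := by rw [Ext.smul_eq_comp_mk₀, hc', Ext.mk₀_zero, Ext.comp_zero]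
  rw [add_smul, h1, h2, add_zero]

theorem homologyFunctor_map_smul_id (K : ChainComplex (ModuleCat.{u} R) ℕ) (a : R) (i : ℕ) :
    (HomologicalComplex.homologyFunctor (ModuleCat.{u} R) (ComplexShape.down ℕ) i).map (a • 𝟙 K) =
      a • 𝟙 ((HomologicalComplex.homologyFunctor (ModuleCat.{u} R) (ComplexShape.down ℕ) i).obj K)
    := by
  have h : (HomologicalComplex.shortComplexFunctor (ModuleCat.{u} R) (ComplexShape.down ℕ) i).map
      (a • 𝟙 K) = a • 𝟙 (K.sc i) := rfl
  rw [HomologicalComplex.homologyFunctor_map, HomologicalComplex.homologyMap, h,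
    ShortComplex.homologyMap_smul, ShortComplex.homologyMap_id]
  rfl

theorem iso_hom_comp_smul_id_comp_inv {X Y : ModuleCat.{u} R} (e : X ≅ Y) (a : R) :
    e.hom ≫ (a • 𝟙 Y) ≫ e.inv = a • 𝟙 X := by
  rw [Linear.smul_comp, Linear.comp_smul, Category.id_comp, Iso.hom_inv_id]

theorem tor_map_smul_id_app (A L : Type u) [AddCommGroup A] [Module R A] [AddCommGroup L]
    [Module R L] (i : ℕ) (a : R) :
    ((Tor (ModuleCat.{u} R) i).map (a • 𝟙 (ModuleCat.of R A))).app (ModuleCat.of R L) =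
      a • 𝟙 (((Tor (ModuleCat.{u} R) i).obj (ModuleCat.of R A)).obj (ModuleCat.of R L)) := by
  have h : (NatTrans.mapHomologicalComplex
        ((MonoidalCategory.tensoringLeft (ModuleCat.{u} R)).map (a • 𝟙 (ModuleCat.of R A)))
          (ComplexShape.down ℕ)).app (projectiveResolution (ModuleCat.of R L)).complex =
      a • 𝟙 _ := by
    ext j : 1
    exact (MonoidalLinear.smul_whiskerRight a (𝟙 _) _).trans
      (congrArg (a • ·) (MonoidalCategory.id_whiskerRight _ _))
  simp only [Tor_map]
  rw [ProjectiveResolution.leftDerived_app_eq _ (projectiveResolution (ModuleCat.of R L)), h,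
    homologyFunctor_map_smul_id]
  exact iso_hom_comp_smul_id_comp_inv _ a

/-- Tor is derived in this variable, so multiplication by `a` on `L` must be lifted to a projective
resolution; `a • 𝟙` is such a lift. -/
theorem tor_obj_map_smul_id (A L : Type u) [AddCommGroup A] [Module R A] [AddCommGroup L]
    [Module R L] (i : ℕ) (a : R) :
    ((Tor (ModuleCat.{u} R) i).obj (ModuleCat.of R A)).map (a • 𝟙 (ModuleCat.of R L)) =
      a • 𝟙 (((Tor (ModuleCat.{u} R) i).obj (ModuleCat.of R A)).obj (ModuleCat.of R L)) := by
  let F := (MonoidalCategory.tensoringLeft (ModuleCat.{u} R)).obj (ModuleCat.of R A)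
  let P := projectiveResolution (ModuleCat.of R L)
  have h : (F.mapHomologicalComplex (ComplexShape.down ℕ)).map (a • 𝟙 P.complex) = a • 𝟙 _ := by
    ext j : 1
    exact (MonoidalLinear.whiskerLeft_smul (ModuleCat.of R A) a (𝟙 (P.complex.X j))).trans
      (congrArg (a • ·) (MonoidalCategory.whiskerLeft_id _ _))
  have hw : (a • 𝟙 P.complex) ≫ P.π =
      P.π ≫ (ChainComplex.single₀ (ModuleCat.{u} R)).map (a • 𝟙 (ModuleCat.of R L)) := by
    ext : 1
    simp only [HomologicalComplex.comp_f, HomologicalComplex.smul_f_apply,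
      HomologicalComplex.id_f, ChainComplex.single₀_map_f_zero]
    exact (Linear.smul_comp _ _ _ a _ _).trans ((congrArg (a • ·) ((Category.id_comp _).trans
      (Category.comp_id _).symm)).trans (Linear.comp_smul _ _ _ _ a _).symm)
  change (F.leftDerived i).map _ = _
  rw [Functor.leftDerived_map_eq F i _ _ hw, Functor.comp_map, h, homologyFunctor_map_smul_id]
  exact iso_hom_comp_smul_id_comp_inv _ a

theorem torMod_smul_eq_zero {A L : Type u} [AddCommGroup A] [Module R A] [AddCommGroup L]
    [Module R L] {i : ℕ} {a : R} (ha : a ∈ Module.annihilator R A ⊔ Module.annihilator R L)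
    (x : TorMod R A L i) : a • x = 0 := by
  obtain ⟨b, hb, c, hc, rfl⟩ := Submodule.mem_sup.1 ha
  -- Writing zero as `(0 : R) • 𝟙` lets the same scalar lemma evaluate both sides.
  have hb' : b • 𝟙 (ModuleCat.of R A) = (0 : R) • 𝟙 (ModuleCat.of R A) :=
    ModuleCat.hom_ext (LinearMap.ext fun y =>
      (Module.mem_annihilator.1 hb y).trans (zero_smul R y).symm)
  have hc' : c • 𝟙 (ModuleCat.of R L) = (0 : R) • 𝟙 (ModuleCat.of R L) :=
    ModuleCat.hom_ext (LinearMap.ext fun y =>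
      (Module.mem_annihilator.1 hc y).trans (zero_smul R y).symm)
  have h1 : b • x = (0 : R) • x := by
    have h := (tor_map_smul_id_app A L i b).symm.trans
      ((congrArg (fun φ => ((Tor (ModuleCat.{u} R) i).map φ).app (ModuleCat.of R L)) hb').trans (tor_map_smul_id_app A L i 0))
    exact LinearMap.congr_fun (congrArg ModuleCat.Hom.hom h) x
  have h2 : c • x = (0 : R) • x := by
    have h := (tor_obj_map_smul_id A L i c).symm.trans
      ((congrArg ((Tor (ModuleCat.{u} R) i).obj (ModuleCat.of R A)).map hc').trans (tor_obj_map_smul_id A L i 0))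
    exact LinearMap.congr_fun (congrArg ModuleCat.Hom.hom h) x
  rw [add_smul, h1, h2, zero_smul, add_zero]

variable [IsNoetherianRing R] [IsLocalRing R] {A L : Type u} [AddCommGroup A] [Module R A]
  [IsArtinian R A] [AddCommGroup L] [Module R L]

instance ExtMod.isScalarTower (i : ℕ) : IsScalarTower R (MCompletion R) (ExtMod R A L i) :=
  IsScalarTower.of_algebraMap_smul fun a x => by
    change (Ext.mk₀ (ModuleCat.ofHom (completionEnd A (algebraMap R (MCompletion R) a)))).comp x
      (zero_add i) = a • x
    rw [completionEnd_algebraMap, show ModuleCat.ofHom (a • (LinearMap.id : A →ₗ[R] A)) =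
      a • 𝟙 (ModuleCat.of R A) from rfl, Ext.mk₀_smul, Ext.smul_comp, Ext.mk₀_id_comp]

instance TorMod.isScalarTower (i : ℕ) : IsScalarTower R (MCompletion R) (TorMod R A L i) :=
  IsScalarTower.of_algebraMap_smul fun a x => by
    change ((Tor (ModuleCat.{u} R) i).map (ModuleCat.ofHom (completionEnd A
      (algebraMap R (MCompletion R) a)))).app (ModuleCat.of R L) x = a • x
    rw [completionEnd_algebraMap, show ModuleCat.ofHom (a • (LinearMap.id : A →ₗ[R] A)) =
      a • 𝟙 (ModuleCat.of R A) from rfl, tor_map_smul_id_app]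
    rfl

end ScalarActions

/-! ### Completeness of finite modules -/

section AdicLemmas

theorem Submodule.mkQ_mem_smul_top_iff {R X : Type*} [CommRing R] [AddCommGroup X] [Module R X]
    (N : Submodule R X) (I : Ideal R) (x : X) :
    N.mkQ x ∈ (I • ⊤ : Submodule R (X ⧸ N)) ↔ x ∈ N ⊔ I • ⊤ := by
  rw [← Submodule.comap_map_mkQ, Submodule.map_smul'', Submodule.map_top, Submodule.range_mkQ]
  rfl

/-- A finite module killed by an ideal `J` is precomplete if `R ⧸ J` is. -/
theorem IsPrecomplete.of_finite_of_smul_eq_zero {R X : Type*} [CommRing R] [AddCommGroup X]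
    [Module R X] [Module.Finite R X] (I J : Ideal R) [hR : IsPrecomplete I (R ⧸ J)]
    (hJ : ∀ a ∈ J, ∀ x : X, a • x = 0) : IsPrecomplete I X := by
  refine ⟨fun f hf => ?_⟩
  obtain ⟨n, x, hx⟩ := Module.Finite.exists_fin (R := R) (M := X)
  have hmem : ∀ j (y : X), y ∈ (I ^ j • ⊤ : Submodule R X) ↔
      ∃ c : Fin n → R, (∀ k, c k ∈ I ^ j) ∧ ∑ k, c k • x k = y := by
    intro j y
    rw [← hx, Submodule.mem_ideal_smul_span_iff_exists_sum]
    constructor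
    · rintro ⟨c, hc, rfl⟩
      exact ⟨c, hc, (Finsupp.sum_fintype c (fun k b => b • x k) fun _ => zero_smul _ _).symm⟩
    · rintro ⟨c, hc, rfl⟩
      exact ⟨Finsupp.equivFunOnFinite.symm c, hc, Finsupp.sum_fintype _ (fun k b => b • x k) fun _ => zero_smul _ _⟩
  have hstep : ∀ j, ∃ c : Fin n → R, (∀ k, c k ∈ I ^ j) ∧ ∑ k, c k • x k = f (j + 1) - f j :=
    fun j => (hmem j _).1 (SModEq.sub_mem.1 (hf j.le_succ).symm)
  choose c hc hsum using hstep
  let s : ℕ → Fin n → R := fun j k => ∑ l ∈ Finset.range j, c l k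
  have hfs : ∀ j, f j = f 0 + ∑ k, s j k • x k := by
    intro j
    induction j with
    | zero => simp [s]
    | succ j ih =>
      simp only [s, Finset.sum_range_succ, add_smul, Finset.sum_add_distrib]
      rw [hsum, ← add_assoc]
      simp only [s] at ih
      rw [← ih]
      abel
  have hs : ∀ k i j, i ≤ j → s j k - s i k ∈ I ^ i := by
    intro k i j hij
    simp only [s]
    rw [← Finset.sum_Ico_eq_sub _ hij]
    exact Ideal.sum_mem _ fun l hl =>
      Ideal.pow_le_pow_right (Finset.mem_Ico.1 hl).1 (hc l k)
  -- The coefficient sequences converge only modulo `J`, which suffices because `J` kills `X`.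
  have hlim : ∀ k, ∃ a : R, ∀ j, s j k - a ∈ J ⊔ I ^ j := by
    intro k
    obtain ⟨z, hz⟩ := hR.prec (f := fun j => J.mkQ (s j k)) fun {i j} hij => by
      rw [SModEq.sub_mem, ← map_sub, Submodule.mkQ_mem_smul_top_iff]
      refine Submodule.mem_sup_right ?_
      rw [smul_eq_mul, Ideal.mul_top, ← neg_sub]
      exact Ideal.neg_mem_iff _ |>.2 (hs k i j hij)
    obtain ⟨a, rfl⟩ := Submodule.mkQ_surjective _ z
    refine ⟨a, fun j => ?_⟩
    have := hz j
    rwa [SModEq.sub_mem, ← map_sub, Submodule.mkQ_mem_smul_top_iff, smul_eq_mul,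
      Ideal.mul_top] at this
  choose a ha using hlim
  refine ⟨f 0 + ∑ k, a k • x k, fun j => ?_⟩
  rw [SModEq.sub_mem, hfs j, add_sub_add_left_eq_sub, ← Finset.sum_sub_distrib]
  refine Submodule.sum_mem _ fun k _ => ?_
  rw [← sub_smul]
  obtain ⟨b, hb, e, he, hbe⟩ := Submodule.mem_sup.1 (ha k j)
  rw [← hbe, add_smul, hJ b hb, zero_add]
  exact Submodule.smul_mem_smul he trivial

end AdicLemmas

/-! ### Reflexivity criteria -/

section Reflexivity

variable {R E : Type u} [CommRing R] [IsLocalRing R] [AddCommGroup E] [Module R E]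
  {ι : ResidueField R →ₗ[R] E} {X : Type u} [AddCommGroup X] [Module R X]

namespace IsInjectiveHull

/-- Otherwise `ψ` takes the value `ι 1` on every `maximalIdeal R ^ j • ⊤`. An `x` with `ψ x = ι 1`
then lies in `ker ψ` plus each of these submodules, hence in `ker ψ` by separatedness of the
quotient. -/
theorem exists_pow_smul_top_le_ker (hι : IsInjectiveHull ι)
    (hX : ∀ N : Submodule R X, IsHausdorff (maximalIdeal R) (X ⧸ N)) (ψ : X →ₗ[R] E) :
    ∃ j : ℕ, (maximalIdeal R ^ j • ⊤ : Submodule R X) ≤ LinearMap.ker ψ := by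
  by_contra hcon
  push Not at hcon
  have hone : ∀ j : ℕ, ∃ x ∈ (maximalIdeal R ^ j • ⊤ : Submodule R X), ψ x = ι 1 := by
    intro j
    refine hι.one_mem (N := Submodule.map ψ (maximalIdeal R ^ j • ⊤)) fun h => hcon j ?_
    exact fun x hx => (Submodule.eq_bot_iff _).1 h _ ⟨x, hx, rfl⟩
  obtain ⟨x, -, hx⟩ := hone 0
  have h0 : (LinearMap.ker ψ).mkQ x = 0 := by
    refine (hX (LinearMap.ker ψ)).haus _ fun j => ?_
    rw [SModEq.zero, Submodule.mkQ_mem_smul_top_iff]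
    obtain ⟨y, hy, hyx⟩ := hone j
    rw [← sub_add_cancel x y]
    exact Submodule.add_mem_sup (by simp [hx, hyx]) hy
  have : ψ x = 0 := by simpa using h0
  exact hι.one_ne_zero (hx ▸ this)

/-- Complete noetherian modules are reflexive. -/
theorem bidualityMap_bijective_of_isPrecomplete (hι : IsInjectiveHull ι) [IsNoetherian R X]
    (hX : ∀ N : Submodule R X, IsHausdorff (maximalIdeal R) (X ⧸ N))
    (hp : IsPrecomplete (maximalIdeal R) X) : Function.Bijective (bidualityMap R X E) := by
  refine ⟨hι.bidualityMap_injective, fun φ => ?_⟩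
  let N : ℕ → Submodule R X := fun j => maximalIdeal R ^ j • ⊤
  -- On functionals that factor through the finite length quotient `X ⧸ N j`, `φ` is evaluation at
  -- some `x j`. These points converge, and every functional factors through some such quotient.
  have hex : ∀ j, ∃ x : X, ∀ ψ : X →ₗ[R] E, N j ≤ LinearMap.ker ψ → φ ψ = ψ x := by
    intro j
    have hfl : IsFiniteLength R (X ⧸ N j) :=
      isFiniteLength_of_maximalIdeal_pow_smul_eq_zero j fun a ha z => by
        obtain ⟨y, rfl⟩ := Submodule.mkQ_surjective _ z
        rw [← map_smul]
        exact (Submodule.Quotient.mk_eq_zero _).2 (Submodule.smul_mem_smul ha trivial)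
    obtain ⟨z, hz⟩ := (hι.bidualityMap_bijective_of_isFiniteLength hfl).2
      (φ ∘ₗ LinearMap.lcomp R E (N j).mkQ)
    obtain ⟨x, rfl⟩ := Submodule.mkQ_surjective _ z
    refine ⟨x, fun ψ hψ => ?_⟩
    have h1 := LinearMap.congr_fun hz ((N j).liftQ ψ hψ)
    have h2 : (N j).liftQ ψ hψ ∘ₗ (N j).mkQ = ψ := Submodule.liftQ_mkQ _ _ _
    change (N j).liftQ ψ hψ ((N j).mkQ x) = φ ((N j).liftQ ψ hψ ∘ₗ (N j).mkQ) at h1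
    rw [h2] at h1
    rw [← h1]
    rfl
  choose x hx using hex
  have hanti : ∀ {i j}, i ≤ j → N j ≤ N i := fun h =>
    Submodule.smul_mono_left (Ideal.pow_le_pow_right h)
  obtain ⟨y, hy⟩ := hp.prec (f := x) fun {i j} hij => by
    rw [SModEq.sub_mem]
    refine hι.mem_of_forall_apply_eq_zero fun ψ hψ => ?_
    rw [map_sub, ← hx i ψ hψ, ← hx j ψ ((hanti hij).trans hψ), sub_self]
  refine ⟨y, LinearMap.ext fun ψ => ?_⟩
  obtain ⟨j, hj⟩ := hι.exists_pow_smul_top_le_ker hX ψ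
  have h1 : ψ (x j - y) = 0 := hj (SModEq.sub_mem.1 (hy j))
  rw [map_sub, sub_eq_zero] at h1
  rw [hx j ψ hj, h1]
  rfl

/-- A module with reflexive dual is reflexive. -/
theorem bidualityMap_bijective_of_dual (hι : IsInjectiveHull ι)
    (h : Function.Bijective (bidualityMap R (X →ₗ[R] E) E)) :
    Function.Bijective (bidualityMap R X E) := by
  refine ⟨hι.bidualityMap_injective, fun φ => ?_⟩
  suffices hφ : φ ∈ LinearMap.range (bidualityMap R X E) from hφ
  refine hι.mem_of_forall_apply_eq_zero fun Ψ hΨ => ?_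
  -- Reflexivity of the dual turns `Ψ` into evaluation at `ψ`; vanishing on the image of `X` then
  -- says `ψ = 0`.
  obtain ⟨ψ, rfl⟩ := h.2 Ψ
  have hψ : ψ = 0 := LinearMap.ext fun x => hΨ ⟨x, rfl⟩
  rw [hψ, map_zero, LinearMap.zero_apply]

/-- Taking annihilators in the dual reverses inclusions strictly, because `E` is a cogenerator. -/
theorem isArtinian_of_isNoetherian_dual (hι : IsInjectiveHull ι)
    [IsNoetherian R (X →ₗ[R] E)] : IsArtinian R X := by
  let f (N : Submodule R X) : Submodule R (X →ₗ[R] E) :=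
    { carrier := {ψ | N ≤ LinearMap.ker ψ}
      add_mem' := fun hψ hχ x hx => by
        rw [LinearMap.mem_ker, LinearMap.add_apply, LinearMap.mem_ker.1 (hψ hx),
          LinearMap.mem_ker.1 (hχ hx), add_zero]
      zero_mem' := fun _ _ => rfl
      smul_mem' := fun a ψ hψ x hx => by
        rw [LinearMap.mem_ker, LinearMap.smul_apply, LinearMap.mem_ker.1 (hψ hx), smul_zero] }
  have hle : ∀ N N', f N' ≤ f N → N ≤ N' := fun N N' h x hx =>
    hι.mem_of_forall_apply_eq_zero fun ψ hψ => h hψ hx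
  have hf : StrictAnti f := fun N N' h =>
    lt_of_le_not_ge (fun ψ hψ => h.le.trans hψ) fun hcon => h.not_ge (hle _ _ hcon)
  exact hf.wellFoundedLT

/-- Annihilators are taken in `X` itself; reflexivity makes this strict, since every functional on
the dual is evaluation at an element of `X`. -/
theorem isArtinian_dual_of_isNoetherian (hι : IsInjectiveHull ι) [IsNoetherian R X]
    (h : Function.Bijective (bidualityMap R X E)) : IsArtinian R (X →ₗ[R] E) := by
  let f (N : Submodule R (X →ₗ[R] E)) : Submodule R X :=
    { carrier := {x | ∀ ψ ∈ N, ψ x = 0}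
      add_mem' := fun hx hy ψ hψ => by rw [map_add, hx ψ hψ, hy ψ hψ, add_zero]
      zero_mem' := fun ψ _ => map_zero ψ
      smul_mem' := fun a x hx ψ hψ => by rw [map_smul, hx ψ hψ, smul_zero] }
  have hle : ∀ N N', f N' ≤ f N → N ≤ N' := fun N N' hN ψ hψ =>
    hι.mem_of_forall_apply_eq_zero fun Φ hΦ => by
      obtain ⟨x, rfl⟩ := h.2 Φ
      exact hN (fun χ hχ => hΦ hχ) ψ hψ
  have hf : StrictAnti f := fun N N' h =>
    lt_of_le_not_ge (fun x hx ψ hψ => hx ψ (h.le hψ)) fun hcon => h.not_ge (hle _ _ hcon)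
  exact hf.wellFoundedLT

end IsInjectiveHull

end Reflexivity

/-! ### Reflexivity over the ring and its completion, treated uniformly as `T` -/

section ReflexivityOverCompletion

variable {R T : Type u} [CommRing R] [IsNoetherianRing R] [IsLocalRing R] [CommRing T]
  [IsLocalRing T] [Algebra R T] {J : Ideal R}
  {X : Type u} [AddCommGroup X] [Module R X] [Module T X] [IsScalarTower R T X]

theorem smul_eq_zero_of_mem_map {R T X : Type*} [CommRing R] [CommRing T] [Algebra R T]
    [AddCommGroup X] [Module R X] [Module T X] [IsScalarTower R T X] {J : Ideal R} {x : X}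
    (hJ : ∀ a ∈ J, a • x = 0) {t : T} (ht : t ∈ J.map (algebraMap R T)) : t • x = 0 := by
  induction ht using Submodule.span_induction with
  | mem t ht =>
    obtain ⟨a, ha, rfl⟩ := ht
    rw [algebraMap_smul, hJ a ha]
  | zero => exact zero_smul T x
  | add s t _ _ hs ht => rw [add_smul, hs, ht, add_zero]
  | smul s t _ ht => rw [smul_eq_mul, mul_smul, ht, smul_zero]

theorem exists_forall_smul_eq_smul {R T X : Type*} [CommRing R] [CommRing T] [Algebra R T]
    [AddCommGroup X] [Module R X] [Module T X] [IsScalarTower R T X] {J : Ideal R}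
    (hT : ∀ t : T, ∃ a : R, t - algebraMap R T a ∈ J.map (algebraMap R T))
    (hJ : ∀ a ∈ J, ∀ x : X, a • x = 0) (t : T) : ∃ a : R, ∀ x : X, t • x = a • x := by
  obtain ⟨a, ha⟩ := hT t
  refine ⟨a, fun x => ?_⟩
  have := smul_eq_zero_of_mem_map (fun b hb => hJ b hb x) ha
  rwa [sub_smul, algebraMap_smul, sub_eq_zero] at this

/-- Viewed over `R`, the quotient is a finite module over a noetherian local ring, so Krull's
intersection theorem applies, and both maximal ideals give the same filtration. -/
theorem isHausdorff_quotient_of_isNoetherian [IsNoetherian R X]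
    (hm : maximalIdeal T = (maximalIdeal R).map (algebraMap R T)) (N : Submodule T X) :
    IsHausdorff (maximalIdeal T) (X ⧸ N) := by
  have : IsNoetherian R (X ⧸ N) :=
    isNoetherian_of_surjective (N.mkQ.restrictScalars R)
      (LinearMap.range_eq_top.2 N.mkQ_surjective)
  rw [hm, IsHausdorff.map_algebraMap_iff]
  infer_instance

theorem IsInjectiveHull.bidualityMap_bijective_of_isNoetherian {E : Type u} [AddCommGroup E]
    [Module T E] {ι : ResidueField T →ₗ[T] E} (hι : IsInjectiveHull ι) [IsNoetherian R X]
    (hm : maximalIdeal T = (maximalIdeal R).map (algebraMap R T))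
    (hJ : ∀ a ∈ J, ∀ x : X, a • x = 0) [IsPrecomplete (maximalIdeal R) (R ⧸ J)] :
    Function.Bijective (bidualityMap T X E) := by
  have := isNoetherian_of_tower R (S := T) (M := X) inferInstance
  refine hι.bidualityMap_bijective_of_isPrecomplete
    (isHausdorff_quotient_of_isNoetherian hm) ?_
  rw [hm, IsPrecomplete.map_algebraMap_iff]
  exact IsPrecomplete.of_finite_of_smul_eq_zero _ J hJ

theorem isMatlisReflexive_of_isNoetherian [IsNoetherian R X]
    (hm : maximalIdeal T = (maximalIdeal R).map (algebraMap R T))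
    (hJ : ∀ a ∈ J, ∀ x : X, a • x = 0) [IsPrecomplete (maximalIdeal R) (R ⧸ J)] :
    IsMatlisReflexive T X := by
  obtain ⟨E, _, _, ι, hι⟩ := exists_isInjectiveHull T (ResidueField T)
  exact ⟨E, _, _, ι, hι, hι.bidualityMap_bijective_of_isNoetherian hm hJ⟩

/-- The dual is noetherian over `End E`. An endomorphism acts on the torsion of `K ⊔ maximalIdeal T
^ j` by coherent scalars, which converge in `T ⧸ K`. Since `K` kills `X`, this limit suffices and
`T` itself need not be complete. -/
theorem IsInjectiveHull.isNoetherian_dual_of_isArtinian {E : Type u} [AddCommGroup E]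
    [Module T E] {ι : ResidueField T →ₗ[T] E} (hι : IsInjectiveHull ι) [IsArtinian R X]
    (hm : maximalIdeal T = (maximalIdeal R).map (algebraMap R T))
    (hT : ∀ t : T, ∃ a : R, t - algebraMap R T a ∈ J.map (algebraMap R T))
    (hJ : ∀ a ∈ J, ∀ x : X, a • x = 0) [IsPrecomplete (maximalIdeal R) (R ⧸ J)] :
    IsNoetherian T (X →ₗ[T] E) := by
  have := hι.injective_module
  have := isArtinian_of_tower R (S := T) (M := X) inferInstance
  have := isNoetherian_end_dual (R := T) (X := X) (E := E)
  set K := J.map (algebraMap R T)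
  have hJK : ∀ a ∈ J, ∀ z : T ⧸ K, a • z = 0 := fun a ha z => by
    obtain ⟨t, rfl⟩ := Submodule.mkQ_surjective _ z
    rw [← algebraMap_smul T a, ← map_smul]
    exact (Submodule.Quotient.mk_eq_zero _).2 (K.mul_mem_right t (Ideal.mem_map_of_mem _ ha))
  have hsurj : Function.Surjective (K.mkQ.restrictScalars R ∘ₗ Algebra.linearMap R T) := by
    intro z
    obtain ⟨t, rfl⟩ := Submodule.mkQ_surjective _ z
    obtain ⟨a, ha⟩ := hT t
    exact ⟨a, ((Submodule.Quotient.eq K).2 ha).symm⟩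
  have hnoeth : IsNoetherian R (T ⧸ K) := isNoetherian_of_surjective _ (LinearMap.range_eq_top.2 hsurj)
  have hpre : IsPrecomplete (maximalIdeal T) (T ⧸ K) := by
    rw [hm, IsPrecomplete.map_algebraMap_iff]
    exact IsPrecomplete.of_finite_of_smul_eq_zero _ J hJK
  have := isNoetherian_of_tower R (S := T) (M := T ⧸ K) inferInstance
  refine IsNoetherian.of_forall_exists_smul_eq (S' := Module.End T E) fun h f => ?_
  let 𝔞 : ℕ → Ideal T := fun j => K ⊔ maximalIdeal T ^ j
  have hfl : ∀ j, IsFiniteLength T (T ⧸ 𝔞 j) := fun j => by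
    have : IsNoetherian T (T ⧸ 𝔞 j) := isNoetherian_of_surjective
      (Submodule.factor (le_sup_left : K ≤ 𝔞 j))
      (LinearMap.range_eq_top.2 (Submodule.factor_surjective _))
    refine isFiniteLength_of_maximalIdeal_pow_smul_eq_zero j fun a ha z => ?_
    obtain ⟨t, rfl⟩ := Submodule.mkQ_surjective _ z
    rw [← map_smul]
    exact (Submodule.Quotient.mk_eq_zero _).2
      ((𝔞 j).mul_mem_right t (Submodule.mem_sup_right ha))
  obtain ⟨a, ha, hcauchy⟩ := hι.exists_end_apply_eq_smul_of_antitone h 𝔞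
    (fun i j hij => sup_le_sup_left (Ideal.pow_le_pow_right hij) K) hfl
  obtain ⟨z, hz⟩ := hpre.prec (f := fun j => K.mkQ (a j)) fun {i j} hij => by
    rw [SModEq.sub_mem, ← map_sub, Submodule.mkQ_mem_smul_top_iff, smul_eq_mul, Ideal.mul_top]
    exact hcauchy i j hij
  obtain ⟨b, rfl⟩ := Submodule.mkQ_surjective _ z
  refine ⟨b, LinearMap.ext fun x => ?_⟩
  obtain ⟨n, hn⟩ := exists_maximalIdeal_pow_smul_eq_zero (R := R) x
  have hkill : ∀ c ∈ 𝔞 n, c • f x = 0 := by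
    intro c hc
    obtain ⟨k, hk, e, he, rfl⟩ := Submodule.mem_sup.1 hc
    rw [hm, ← Ideal.map_pow] at he
    rw [← map_smul, add_smul, smul_eq_zero_of_mem_map (fun r hr => hJ r hr x) hk,
      smul_eq_zero_of_mem_map hn he, add_zero, map_zero]
  have hbn : a n - b ∈ 𝔞 n := by
    have := hz n
    rwa [SModEq.sub_mem, ← map_sub, Submodule.mkQ_mem_smul_top_iff, smul_eq_mul,
      Ideal.mul_top] at this
  have h1 := hkill _ hbn
  rw [sub_smul, sub_eq_zero] at h1
  exact (ha n _ hkill).trans h1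

/-- The dual is noetherian over `T` and killed by `J`, so `T` acts on it through `R`. It is thus
noetherian over `R` and reflexive, and reflexivity passes back to `X`. -/
theorem isMatlisReflexive_of_isArtinian [IsArtinian R X]
    (hm : maximalIdeal T = (maximalIdeal R).map (algebraMap R T))
    (hT : ∀ t : T, ∃ a : R, t - algebraMap R T a ∈ J.map (algebraMap R T))
    (hJ : ∀ a ∈ J, ∀ x : X, a • x = 0) [IsPrecomplete (maximalIdeal R) (R ⧸ J)] :
    IsMatlisReflexive T X := by
  obtain ⟨E, _, _, ι, hι⟩ := exists_isInjectiveHull T (ResidueField T)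
  refine ⟨E, _, _, ι, hι, hι.bidualityMap_bijective_of_dual ?_⟩
  let _ : Module R (X →ₗ[T] E) := Module.compHom _ (algebraMap R T)
  have : IsScalarTower R T (X →ₗ[T] E) := IsScalarTower.of_algebraMap_smul fun _ _ => rfl
  have hJ' : ∀ a ∈ J, ∀ f : X →ₗ[T] E, a • f = 0 := fun a ha f => LinearMap.ext fun x => by
    rw [← algebraMap_smul T a f, LinearMap.smul_apply, ← map_smul, algebraMap_smul, hJ a ha,
      map_zero]
    rfl
  have := hι.isNoetherian_dual_of_isArtinian (X := X) hm hT hJ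
  have : IsNoetherian R (X →ₗ[T] E) := IsNoetherian.of_forall_exists_smul_eq (S' := T)
    fun t f => (exists_forall_smul_eq_smul hT hJ' t).imp fun a h => h f
  exact hι.bidualityMap_bijective_of_isNoetherian hm hJ'

end ReflexivityOverCompletion

/-! ### Finiteness of Ext and Tor, and the theorem -/

section ExtTor

variable {R : Type u} [CommRing R] [IsLocalRing R] [IsNoetherianRing R]
  {A L : Type u} [AddCommGroup A] [Module R A] [AddCommGroup L] [Module R L] [IsArtinian R A]

theorem isNoetherian_extMod
    [IsPrecomplete (maximalIdeal R) (R ⧸ (Module.annihilator R A ⊔ Module.annihilator R L))]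
    {i : ℕ} (h : bassNumber R L i < ⊤) : IsNoetherian R (ExtMod R A L i) := by
  have := (isFiniteLength_iff_isNoetherian_isArtinian.1 (Module.length_ne_top_iff.1 h.ne)).2
  obtain ⟨I, Z, _, _, _, _, _, d, hd⟩ := exists_injective_presentation_ext (R := R) L i
  obtain ⟨ρk, -, hρk⟩ := hd (ResidueField R)
  obtain ⟨ρ, hρ, hρ0⟩ := hd A
  exact isNoetherian_of_surjective_hom d ρk (fun f => (hρk f).1) ρ hρ
    (fun g => (hρ0 _).2 ⟨g, rfl⟩) _ fun a ha x => extMod_smul_eq_zero ha x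

theorem isArtinian_torMod
    [IsPrecomplete (maximalIdeal R) (R ⧸ (Module.annihilator R A ⊔ Module.annihilator R L))]
    {i : ℕ} (h : bettiNumber R L i < ⊤) : IsArtinian R (TorMod R A L i) := by
  have hfl := Module.length_ne_top_iff.1 h.ne
  have := (isFiniteLength_iff_isNoetherian_isArtinian.1 hfl).1
  obtain ⟨E, _, _, ι, hι⟩ := exists_isInjectiveHull R (ResidueField R)
  have := hι.injective_module
  -- The dual of `Tor_i(k, L)` plays the role that `Ext^i(k, L)` plays in the first part.
  have := hι.isArtinian_dual_of_isNoetherian (hι.bidualityMap_bijective_of_isFiniteLength hfl)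
  obtain ⟨I, Z, _, _, _, _, _, d, hd⟩ := exists_injective_presentation_dual_tor (R := R) L E i
  obtain ⟨ρk, -, hρk⟩ := hd (ResidueField R)
  obtain ⟨ρ, hρ, hρ0⟩ := hd A
  have := isNoetherian_of_surjective_hom d ρk (fun f => (hρk f).1) ρ hρ
    (fun g => (hρ0 _).2 ⟨g, rfl⟩) _ fun a ha f => LinearMap.ext fun x => by
      rw [LinearMap.smul_apply, ← map_smul, torMod_smul_eq_zero ha, map_zero]
      rfl
  exact hι.isArtinian_of_isNoetherian_dual

end ExtTor

theorem theoremD (R : Type u) [CommRing R] [IsLocalRing R] [IsNoetherianRing R]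
    (A L : Type u) [AddCommGroup A] [Module R A] [AddCommGroup L] [Module R L]
    [IsArtinian R A]
    (hcomplete : IsAdicComplete (maximalIdeal R)
      (R ⧸ (Module.annihilator R A ⊔ Module.annihilator R L)))
    (i : ℕ) :
    (bassNumber R L i < ⊤ →
      IsNoetherian R (ExtMod R A L i) ∧
      IsNoetherian (MCompletion R) (ExtMod R A L i) ∧
      IsMatlisReflexive R (ExtMod R A L i) ∧
      IsMatlisReflexive (MCompletion R) (ExtMod R A L i)) ∧
    (bettiNumber R L i < ⊤ →
      IsArtinian R (TorMod R A L i) ∧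
      IsArtinian (MCompletion R) (TorMod R A L i) ∧
      IsMatlisReflexive R (TorMod R A L i) ∧
      IsMatlisReflexive (MCompletion R) (TorMod R A L i)) := by
  set J := Module.annihilator R A ⊔ Module.annihilator R L
  have hm : maximalIdeal R = (maximalIdeal R).map (algebraMap R R) := (Ideal.map_id _).symm
  have hm' : maximalIdeal (MCompletion R) = (maximalIdeal R).map (algebraMap R (MCompletion R)) :=
    AdicCompletion.maximalIdeal_eq_map
  have hT : ∀ t : R, ∃ a : R, t - algebraMap R R a ∈ J.map (algebraMap R R) := fun t =>
    ⟨t, by simp⟩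
  have hT' : ∀ t : MCompletion R, ∃ a : R, t - algebraMap R _ a ∈
      J.map (algebraMap R (MCompletion R)) :=
    AdicCompletion.exists_sub_algebraMap_mem_map (maximalIdeal R) J
  refine ⟨fun h => ?_, fun h => ?_⟩
  · have hkill : ∀ a ∈ J, ∀ x : ExtMod R A L i, a • x = 0 := fun a ha x => extMod_smul_eq_zero ha x
    have := isNoetherian_extMod (A := A) h
    exact ⟨this, isNoetherian_of_tower R this, isMatlisReflexive_of_isNoetherian hm hkill,
      isMatlisReflexive_of_isNoetherian hm' hkill⟩
  · have hkill : ∀ a ∈ J, ∀ x : TorMod R A L i, a • x = 0 := fun a ha x => torMod_smul_eq_zero ha x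
    have := isArtinian_torMod (A := A) h
    exact ⟨this, isArtinian_of_tower R this, isMatlisReflexive_of_isArtinian hm hT hkill,
      isMatlisReflexive_of_isArtinian hm' hT' hkill⟩
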